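/- For an integral domain $R$, the \emph{Golomb space} $G(R)$ is the set $R\setminus\{0\}$ endowed with the topology generated by the coprime cosets, that is, by the sets $(a+I)\setminus\{0\}$ where $a\in R$ and $I$ is a nonzero ideal of $R$ such that $aR+I=R$. \textbf{Theorem.} Let $K$ be an algebraic extension of $\mathbb{Q}$, and let $R$ be a Dedekind domain with quotient field $K$. If $G(R)$ is homeomorphic to $G(\mathbb{Z})$, then $R=\mathbb{Z}$; that is, the canonical ring homomorphism $\mathbb{Z}\to R$ is bijective. -/

import Mathlib

/-- The underlying set of the Golomb space of a ring `R`: the nonzero elements of `R`.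
It is a `def` (not reducible), so that it does not inherit a subspace topology
(such as the discrete one when `R = ℤ`). -/
def GolombSpace (R : Type*) [CommRing R] : Type _ := {x : R // x ≠ 0}

namespace GolombSpace

/-- The nonzero part of the coset `a + I`, as a subset of the Golomb space. If `a` and `I` are
coprime and `I ≠ R`, the coset does not contain `0`, so this is the whole coset. -/
def coset {R : Type*} [CommRing R] (a : R) (I : Ideal R) : Set (GolombSpace R) :=
  {x | x.1 - a ∈ I}

/-- The Golomb topology: the topology on the nonzero elements of `R` generated by the coprime
cosets, i.e. the cosets `a + I` of nonzero ideals `I` with `⟨a, I⟩ = R`. -/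
instance {R : Type*} [CommRing R] : TopologicalSpace (GolombSpace R) :=
  TopologicalSpace.generateFrom
    {U | ∃ (a : R) (I : Ideal R), I ≠ ⊥ ∧ Ideal.span {a} ⊔ I = ⊤ ∧ U = coset a I}

end GolombSpace

/-!
Write `V(x)` for the set of prime ideals containing `x`, and let `h : G(R) ≃ G(ℤ)` be a
homeomorphism of Golomb spaces.

*Units and primes.* In a Dedekind domain, the closure of a coset `a + ∏ Pᵢ ^ eᵢ` consists of the
`y` such that, for each `i`, either `y ∈ Pᵢ` or `y ≡ a` modulo `Pᵢ ^ eᵢ`. By examining the sets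
`closure U ∩ closure V` for neighbourhoods `U`, `V` of two points, one finds topological
descriptions of the units (`isUnitPoint_iff`) and of the relation `V(y) ⊆ V(x)` (`closureLE_iff`).
So `h` preserves both. In particular the units of `R` are `±1`. The prime numbers are prime elements
for the order by `V`, and this forces `V(h⁻¹(q))` to be a single prime for each prime number `q`
(`eq_of_map_prime`), whatever the class group of `R` is. So `h` matches the nonzero primes `Q` of
`R` with the prime numbers `q`, in such a way that `x ∈ Q` if and only if `q ∣ h x`.

*Adic topologies.* Among the points outside `Q`, the relatively clopen sets are exactly those that
are clopen for the `Q`-adic topology (`coset_pow_subset_of_isOpen`). Hence `h` is a homeomorphism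
from the `Q`-adic to the `q`-adic topology there (`exists_coset_pow_subset_preimage`).

*Contradiction at a ramified prime.* For prime numbers `p ≠ q`, the powers of `p` are `q`-adically
dense near `1` (`exists_prime_pow_sub_dvd`). They correspond to points of `R` lying in no prime other
than the prime `P` matched with `p`, and these are of the form `± π ^ k` for a fixed `π`, because the
units of `R` are `±1` (`exists_generator_of_pow`). So the `± π ^ k` are `Q`-adically dense near some
point, for every `Q ≠ P`. If a prime number `l` lies in `Q ^ 2`, this is impossible
(`not_dense_powers`): `(1 + Q ^ N) / (1 + Q ^ (N + 6))` is too large, in comparison with its exponent,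
to be contained in a group generated by `-1` and one more element.

*Existence of a ramified prime.* Since `R` has only the units `±1`, so has the ring of integers of
each number field in `K`. By Dirichlet's unit theorem, every element of `K` has degree at most `2`
over `ℚ`. If all have degree `1`, then `R = ℤ`. Otherwise `R` contains a square root of a squarefree
integer `D ≠ 1`, where `D ≠ -1` because of the units, and each prime divisor of `D` ramifies
(`bijective_or_exists_ramified`).
-/

namespace GolombSpace

/-! ### Coprimality and prime powers in Dedekind domains -/

section Ideals

variable {R : Type*} [CommRing R]

lemma mem_left_of_mem_mul {I J : Ideal R} {z : R} (h : z ∈ I * J) : z ∈ I :=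
  (Ideal.mul_le_left : I * J ≤ I) h

lemma mem_right_of_mem_mul {I J : Ideal R} {z : R} (h : z ∈ I * J) : z ∈ J :=
  (Ideal.mul_le_right : I * J ≤ J) h

lemma span_sup_eq_top_iff {a : R} {I : Ideal R} :
    Ideal.span {a} ⊔ I = ⊤ ↔ ∀ P : Ideal R, P.IsMaximal → I ≤ P → a ∉ P := by
  constructor
  · intro h P hP hI ha
    apply hP.ne_top
    rw [eq_top_iff, ← h]
    exact sup_le ((Ideal.span_singleton_le_iff_mem _).2 ha) hI
  · intro h
    by_contra hne
    obtain ⟨M, hM, hle⟩ := Ideal.exists_le_maximal _ hne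
    exact h M hM (le_sup_right.trans hle)
      ((Ideal.span_singleton_le_iff_mem _).1 (le_sup_left.trans hle))

lemma sup_eq_top_iff {I J : Ideal R} :
    I ⊔ J = ⊤ ↔ ∀ P : Ideal R, P.IsMaximal → I ≤ P → ¬ J ≤ P := by
  constructor
  · intro h P hP hI hJ
    exact hP.ne_top (eq_top_iff.2 (h ▸ sup_le hI hJ))
  · intro h
    by_contra hne
    obtain ⟨M, hM, hle⟩ := Ideal.exists_le_maximal _ hne
    exact h M hM (le_sup_left.trans hle) (le_sup_right.trans hle)

lemma span_sup_mul_eq_top {a : R} {I J : Ideal R} (hI : Ideal.span {a} ⊔ I = ⊤)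
    (hJ : Ideal.span {a} ⊔ J = ⊤) : Ideal.span {a} ⊔ I * J = ⊤ := by
  rw [Ideal.sup_mul_eq_of_coprime_left hI, hJ]

lemma span_sup_pow_eq_top {a : R} {P : Ideal R} (hP : P.IsMaximal) (ha : a ∉ P) (n : ℕ) :
    Ideal.span {a} ⊔ P ^ n = ⊤ := by
  rw [span_sup_eq_top_iff]
  intro M hM hle haM
  have : P ≤ M := hM.isPrime.le_of_pow_le hle
  exact ha ((hP.eq_of_le hM.ne_top this) ▸ haM)

lemma pow_sup_eq_top {P J : Ideal R} (hP : P.IsMaximal) (hJ : ¬ J ≤ P) (n : ℕ) :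
    P ^ n ⊔ J = ⊤ := by
  rw [sup_eq_top_iff]
  intro M hM hle hJM
  have : P ≤ M := hM.isPrime.le_of_pow_le hle
  exact hJ ((hP.eq_of_le hM.ne_top this) ▸ hJM)

variable [IsDedekindDomain R]

lemma exists_eq_pow_mul {P I : Ideal R} (hP : P.IsPrime) (hP0 : P ≠ ⊥) (hI : I ≠ ⊥) :
    ∃ (n : ℕ) (J : Ideal R), ¬ J ≤ P ∧ I = P ^ n * J := by
  obtain ⟨n, J, h, e⟩ := WfDvdMonoid.max_power_factor hI (Ideal.prime_of_isPrime hP0 hP).irreducible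
  exact ⟨n, J, fun hle => h (Ideal.dvd_iff_le.2 hle), e⟩

lemma exists_mem_pow_notMem_pow_succ' {P : Ideal R} (hP : P.IsPrime) (hP0 : P ≠ ⊥) {c : R}
    (hc : c ≠ 0) : ∃ n, c ∈ P ^ n ∧ c ∉ P ^ (n + 1) := by
  obtain ⟨n, J, h, e⟩ := exists_eq_pow_mul (I := Ideal.span {c}) hP hP0 (by simpa using hc)
  refine ⟨n, ?_, fun hmem => h ?_⟩
  · have hmem : c ∈ Ideal.span {c} := Ideal.mem_span_singleton_self c
    rw [e] at hmem
    exact mem_left_of_mem_mul hmem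
  · rw [← Ideal.dvd_iff_le]
    rw [← Ideal.span_singleton_le_iff_mem, e, ← Ideal.dvd_iff_le, pow_succ] at hmem
    exact (mul_dvd_mul_iff_left (pow_ne_zero n hP0)).1 hmem

/-- The Chinese remainder theorem, with the solution chosen nonzero. -/
lemma exists_ne_zero_sub_mem_pow {P J : Ideal R} (hP : P.IsPrime) (hP0 : P ≠ ⊥) (hJ : ¬ J ≤ P)
    (w : R) (n : ℕ) : ∃ z ≠ 0, z - w ∈ P ^ n ∧ z ∈ J := by
  have hm := hP.isMaximal hP0
  have h1 : P ^ n ⊔ J = ⊤ := pow_sup_eq_top hm hJ n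
  have hw : w ∈ P ^ n ⊔ J := h1 ▸ Submodule.mem_top
  obtain ⟨s, hs, t, ht, e⟩ := Submodule.mem_sup.1 hw
  by_cases h0 : t = 0
  · have hne : P ^ n * J ≠ ⊥ :=
      mul_ne_zero (pow_ne_zero n hP0) (fun h => hJ (h.le.trans bot_le))
    obtain ⟨z, hz, hz0⟩ := Submodule.exists_mem_ne_zero_of_ne_bot hne
    refine ⟨z, hz0, ?_, mem_right_of_mem_mul hz⟩
    have : w = s := by rw [← e, h0, add_zero]
    exact sub_mem (mem_left_of_mem_mul hz) (this ▸ hs)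
  · exact ⟨t, h0, by rw [← e]; simpa using neg_mem hs, ht⟩

end Ideals

/-! ### Neighbourhoods and closures in the Golomb space -/

section Closure

variable {R : Type*} [CommRing R]

lemma self_mem_coset (x : GolombSpace R) (I : Ideal R) : x ∈ coset x.1 I := by
  simp [coset]

lemma isOpen_coset {a : R} {I : Ideal R} (hI : I ≠ ⊥) (h : Ideal.span {a} ⊔ I = ⊤) :
    IsOpen (coset a I) :=
  TopologicalSpace.isOpen_generateFrom_of_mem ⟨a, I, hI, h, rfl⟩

lemma exists_coset_subset [IsDomain R] {U : Set (GolombSpace R)} (hU : IsOpen U)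
    {x : GolombSpace R} (hx : x ∈ U) :
    ∃ I : Ideal R, I ≠ ⊥ ∧ Ideal.span {x.1} ⊔ I = ⊤ ∧ coset x.1 I ⊆ U := by
  induction hU with
  | basic s hs =>
    obtain ⟨a, I, hI, hc, rfl⟩ := hs
    have hx' : x.1 - a ∈ I := hx
    refine ⟨I, hI, ?_, fun y hy => ?_⟩
    · rw [span_sup_eq_top_iff] at hc ⊢
      intro P hP hle hxP
      exact hc P hP hle (by simpa using sub_mem hxP (hle hx'))
    · have hy' : y.1 - x.1 ∈ I := hy
      change y.1 - a ∈ I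
      simpa using add_mem hy' hx'
  | univ => exact ⟨⊤, top_ne_bot, by simp, Set.subset_univ _⟩
  | inter s t _ _ hs ht =>
    obtain ⟨I, hI, hc, hsub⟩ := hs hx.1
    obtain ⟨J, hJ, hc', hsub'⟩ := ht hx.2
    exact ⟨I * J, mul_ne_zero hI hJ, span_sup_mul_eq_top hc hc',
      fun y hy => ⟨hsub (mem_left_of_mem_mul hy), hsub' (mem_right_of_mem_mul hy)⟩⟩
  | sUnion S _ hS =>
    obtain ⟨s, hs, hxs⟩ := hx
    obtain ⟨I, hI, hc, hsub⟩ := hS s hs hxs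
    exact ⟨I, hI, hc, hsub.trans (Set.subset_sUnion_of_mem hs)⟩

lemma isOpen_iff_coset [IsDomain R] {U : Set (GolombSpace R)} :
    IsOpen U ↔ ∀ x ∈ U, ∃ I : Ideal R,
      I ≠ ⊥ ∧ Ideal.span {x.1} ⊔ I = ⊤ ∧ coset x.1 I ⊆ U := by
  refine ⟨fun h x hx => exists_coset_subset h hx, fun h => isOpen_iff_mem_nhds.2 fun x hx => ?_⟩
  obtain ⟨I, hI, hc, hsub⟩ := h x hx
  exact Filter.mem_of_superset ((isOpen_coset hI hc).mem_nhds (self_mem_coset x I)) hsub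

lemma sub_mem_of_mem_closure_coset [IsDomain R] {a : R} {I A : Ideal R} (hI : I ≠ ⊥) (hIA : I ≤ A)
    {y : GolombSpace R} (hy : y ∈ closure (coset a I)) (hA : Ideal.span {y.1} ⊔ A = ⊤) :
    y.1 - a ∈ A := by
  have hA0 : A ≠ ⊥ := fun h => hI (le_bot_iff.1 (h ▸ hIA))
  obtain ⟨z, hz, hz'⟩ := mem_closure_iff.1 hy _ (isOpen_coset hA0 hA) (self_mem_coset y A)
  have h1 : z.1 - y.1 ∈ A := hz
  have h2 : z.1 - a ∈ A := hIA hz'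
  simpa using sub_mem h2 h1

lemma mem_closure_coset [IsDomain R] {a : R} {I : Ideal R} (hI : I ≠ ⊥) {y : GolombSpace R}
    (h : ∀ J : Ideal R, J ≠ ⊥ → Ideal.span {y.1} ⊔ J = ⊤ → y.1 - a ∈ I ⊔ J) :
    y ∈ closure (coset a I) := by
  rw [mem_closure_iff]
  intro U hU hyU
  obtain ⟨J, hJ, hc, hsub⟩ := exists_coset_subset hU hyU
  obtain ⟨s, hs, t, ht, e⟩ := Submodule.mem_sup.1 (h J hJ hc)
  by_cases h0 : y.1 - t = 0
  · obtain ⟨z, hz, hz0⟩ := Submodule.exists_mem_ne_zero_of_ne_bot (mul_ne_zero hI hJ)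
    refine ⟨⟨z, hz0⟩, hsub ?_, ?_⟩
    · change z - y.1 ∈ J
      rw [sub_eq_zero.1 h0]
      exact sub_mem (mem_right_of_mem_mul hz) ht
    · change z - a ∈ I
      have : a = -s := by linear_combination e + h0
      rw [this]
      exact sub_mem (mem_left_of_mem_mul hz) (neg_mem hs)
  · refine ⟨⟨y.1 - t, h0⟩, hsub ?_, ?_⟩
    · change y.1 - t - y.1 ∈ J
      simpa using neg_mem ht
    · change y.1 - t - a ∈ I
      have : y.1 - t - a = s := by linear_combination -e
      rwa [this]

/-- Points divisible by every prime that contains `I` lie in the closure of all cosets of `I`. -/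
lemma mem_closure_coset_of_forall_prime [IsDomain R] {a : R} {I : Ideal R} (hI : I ≠ ⊥)
    {y : GolombSpace R} (hy : ∀ P : Ideal R, P.IsMaximal → I ≤ P → y.1 ∈ P) :
    y ∈ closure (coset a I) := by
  refine mem_closure_coset hI fun J _ hc => ?_
  have : I ⊔ J = ⊤ := by
    rw [sup_eq_top_iff]
    intro P hP hle hJ
    exact span_sup_eq_top_iff.1 hc P hP hJ (hy P hP hle)
  exact this ▸ Submodule.mem_top

lemma mem_closure_coset_mul [IsDomain R] {a : R} {I J : Ideal R} (hI : I ≠ ⊥) (hJ : J ≠ ⊥)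
    {y : GolombSpace R} (hyI : y.1 - a ∈ I) (hyJ : y.1 ∈ J) :
    y ∈ closure (coset a (I * J)) := by
  refine mem_closure_coset (mul_ne_zero hI hJ) fun A _ hc => ?_
  have : J ⊔ A = ⊤ := by
    rw [sup_eq_top_iff]
    intro P hP hle hA
    exact span_sup_eq_top_iff.1 hc P hP hA (hle hyJ)
  rw [Ideal.mul_sup_eq_of_coprime_right this]
  exact Ideal.mem_sup_left hyI

/-- For `x ≠ y`, the cosets of `I` through `x` and `y` can be shrunk so that every common point of
their closures lies in all primes containing `I`. -/
lemma mem_of_mem_closure_of_mem_closure [IsDedekindDomain R] {a b : R} (hab : a ≠ b)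
    {I A B : Ideal R} (hA0 : A ≠ ⊥) (hB0 : B ≠ ⊥) (hA : A ≤ Ideal.span {a - b} * I)
    (hB : B ≤ Ideal.span {a - b} * I) {z : GolombSpace R} (hza : z ∈ closure (coset a A))
    (hzb : z ∈ closure (coset b B)) {P : Ideal R} (hP : P.IsMaximal) (hIP : I ≤ P) : z.1 ∈ P := by
  by_contra hz
  have hP0 : P ≠ ⊥ := by
    rintro rfl
    rw [le_bot_iff.1 hIP, Ideal.mul_bot] at hA
    exact hA0 (le_bot_iff.1 hA)
  obtain ⟨n, hn, hn'⟩ := exists_mem_pow_notMem_pow_succ' hP.isPrime hP0 (sub_ne_zero.2 hab)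
  have hle : Ideal.span {a - b} * I ≤ P ^ (n + 1) := by
    rw [pow_succ]
    exact Ideal.mul_mono ((Ideal.span_singleton_le_iff_mem _).2 hn) hIP
  have hc := span_sup_pow_eq_top hP hz (n + 1)
  have h1 := sub_mem_of_mem_closure_coset hA0 (hA.trans hle) hza hc
  have h2 := sub_mem_of_mem_closure_coset hB0 (hB.trans hle) hzb hc
  exact hn' (by simpa using sub_mem h2 h1)

end Closure

/-! ### Topological descriptions of units and of divisibility up to radicals -/

section Invariants

/-- Divisibility up to radicals: every prime ideal containing `y` contains `x`. -/
def RadDvd {R : Type*} [CommRing R] (y x : R) : Prop :=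
  ∀ P : Ideal R, P.IsPrime → y ∈ P → x ∈ P

/-- The purely topological property that characterizes the units of the ring: for some other point
`y`, every nonempty open set has a closure that contains the common points of the closures of
suitable neighbourhoods of `x` and `y`. -/
def IsUnitPoint {X : Type*} [TopologicalSpace X] (x : X) : Prop :=
  ∃ y ≠ x, ∀ W : Set X, IsOpen W → W.Nonempty → ∃ U V : Set X, IsOpen U ∧ IsOpen V ∧ x ∈ U ∧ y ∈ V ∧
    closure U ∩ closure V ⊆ closure W

/-- The comparison of the filters generated by `closure U ∩ closure V`, for neighbourhoods `U` of
`e` and `V` of `x`, respectively of `y`. -/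
def ClosureLE {X : Type*} [TopologicalSpace X] (e y x : X) : Prop :=
  ∀ U V : Set X, IsOpen U → IsOpen V → e ∈ U → x ∈ V →
    ∃ U' V' : Set X, IsOpen U' ∧ IsOpen V' ∧ e ∈ U' ∧ y ∈ V' ∧
      closure U' ∩ closure V' ⊆ closure U ∩ closure V

lemma IsUnitPoint.map {X Y : Type*} [TopologicalSpace X] [TopologicalSpace Y] (h : X ≃ₜ Y) {x : X}
    (hx : IsUnitPoint x) : IsUnitPoint (h x) := by
  obtain ⟨y, hy, H⟩ := hx
  refine ⟨h y, h.injective.ne hy, fun W hW hne => ?_⟩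
  obtain ⟨U, V, hU, hV, hxU, hyV, hsub⟩ := H (h ⁻¹' W) (hW.preimage h.continuous)
    (hne.preimage h.surjective)
  refine ⟨h '' U, h '' V, h.isOpen_image.2 hU, h.isOpen_image.2 hV, Set.mem_image_of_mem _ hxU,
    Set.mem_image_of_mem _ hyV, ?_⟩
  rw [← h.image_closure, ← h.image_closure, ← Set.image_inter h.injective, Set.image_subset_iff,
    h.preimage_closure]
  exact hsub

lemma ClosureLE.map {X Y : Type*} [TopologicalSpace X] [TopologicalSpace Y] (h : X ≃ₜ Y)
    {e y x : X} (H : ClosureLE e y x) : ClosureLE (h e) (h y) (h x) := by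
  intro U V hU hV he hx
  obtain ⟨U', V', hU', hV', he', hy', hsub⟩ :=
    H _ _ (hU.preimage h.continuous) (hV.preimage h.continuous) he hx
  refine ⟨h '' U', h '' V', h.isOpen_image.2 hU', h.isOpen_image.2 hV', Set.mem_image_of_mem _ he',
    Set.mem_image_of_mem _ hy', ?_⟩
  rw [← h.image_closure, ← h.image_closure, ← Set.image_inter h.injective, Set.image_subset_iff,
    Set.preimage_inter, h.preimage_closure, h.preimage_closure]
  exact hsub

lemma not_le_of_span_sup_eq_top {R : Type*} [CommRing R] {a : R} {I P : Ideal R} (hP : P.IsMaximal)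
    (hc : Ideal.span {a} ⊔ I = ⊤) (ha : a ∈ P) : ¬ I ≤ P :=
  fun hle => span_sup_eq_top_iff.1 hc P hP hle ha

variable {R : Type*} [CommRing R] [IsDedekindDomain R]

/-- A unit `u` is paired with `-u`. If `x` is not a unit, it lies in some maximal ideal `P`; then
there is a coset of `P ^ 2`, disjoint from `P`, that contains a common point of the closures of any
two neighbourhoods of `x` and `y`. This point is not in the closure of any other coset of `P ^ 2`. -/
theorem isUnitPoint_iff (h2 : (2 : R) ≠ 0) (x : GolombSpace R) : IsUnitPoint x ↔ IsUnit x.1 := by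
  constructor
  · rintro ⟨y, hy, H⟩
    by_contra hx
    obtain ⟨P, hP, hxP⟩ := exists_max_ideal_of_mem_nonunits hx
    have hP0 : P ≠ ⊥ := fun h => x.2 (by simpa [h] using hxP)
    obtain ⟨t, ht, ht'⟩ := Ideal.exists_mem_pow_notMem_pow_succ P hP0 hP.ne_top 1
    rw [pow_one] at ht
    -- `w` is the residue modulo `P` that the point constructed below must have.
    obtain ⟨w, hwP, hw⟩ : ∃ w : R, w ∉ P ∧ (y.1 ∉ P → w = y.1) := by
      by_cases hyP : y.1 ∈ P
      · exact ⟨1, (Ideal.ne_top_iff_one P).1 hP.ne_top, fun h => absurd hyP h⟩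
      · exact ⟨y.1, hyP, fun _ => rfl⟩
    have hwt : w + t ∉ P := fun h => hwP (by simpa using sub_mem h ht)
    have hc2 := span_sup_pow_eq_top hP hwt 2
    obtain ⟨U, V, hU, hV, hxU, hyV, hsub⟩ := H _ (isOpen_coset (pow_ne_zero 2 hP0) hc2)
      ⟨⟨w + t, fun h => hwt (h ▸ zero_mem P)⟩,
        self_mem_coset (⟨w + t, fun h => hwt (h ▸ zero_mem P)⟩ : GolombSpace R) _⟩
    obtain ⟨I, hI, hcI, hIU⟩ := exists_coset_subset hU hxU
    obtain ⟨J, hJ, hcJ, hJV⟩ := exists_coset_subset hV hyV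
    obtain ⟨n, J', hJ', rfl⟩ := exists_eq_pow_mul hP.isPrime hP0 hJ
    have hIJ : ¬ I * J' ≤ P := fun h => (hP.isPrime.mul_le.1 h).elim
      (not_le_of_span_sup_eq_top hP hcI hxP) hJ'
    obtain ⟨z, hz0, hzw, hzI⟩ := exists_ne_zero_sub_mem_pow hP.isPrime hP0 hIJ w (n + 2)
    have hzP : z ∉ P := fun h => hwP (by
      simpa using sub_mem h (Ideal.pow_le_self (by omega) hzw))
    have hzU : (⟨z, hz0⟩ : GolombSpace R) ∈ closure (coset x.1 I) :=
      mem_closure_coset_of_forall_prime hI fun Q _ hle => hle (mem_left_of_mem_mul hzI)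
    have hzV : (⟨z, hz0⟩ : GolombSpace R) ∈ closure (coset y.1 (P ^ n * J')) := by
      by_cases hyP : y.1 ∈ P
      · have hn : n = 0 := by
          by_contra hn
          exact not_le_of_span_sup_eq_top hP hcJ hyP
            (Ideal.mul_le_left.trans (Ideal.pow_le_self hn))
        subst hn
        exact mem_closure_coset_mul (pow_ne_zero _ hP0) (right_ne_zero_of_mul hJ) (by simp)
          (mem_right_of_mem_mul hzI)
      · rw [← hw hyP]
        exact mem_closure_coset_mul (pow_ne_zero _ hP0) (right_ne_zero_of_mul hJ)
          (Ideal.pow_le_pow_right (by omega) hzw) (mem_right_of_mem_mul hzI)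
    have := sub_mem_of_mem_closure_coset (pow_ne_zero 2 hP0) le_rfl
      (hsub ⟨closure_mono hIU hzU, closure_mono hJV hzV⟩) (span_sup_pow_eq_top hP hzP 2)
    refine ht' ?_
    have h3 := sub_mem (Ideal.pow_le_pow_right (show 2 ≤ n + 2 by omega) hzw) this
    convert h3 using 1
    ring
  · intro hx
    have hne : x.1 ≠ -x.1 := fun h => (mul_ne_zero h2 x.2) (by linear_combination h)
    refine ⟨⟨-x.1, neg_ne_zero.2 x.2⟩, fun h => hne (congrArg Subtype.val h).symm, ?_⟩
    rintro W hW ⟨w, hw⟩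
    obtain ⟨I, hI, hc, hsub⟩ := exists_coset_subset hW hw
    have hne0 : Ideal.span {x.1 - -x.1} * I ≠ ⊥ :=
      mul_ne_zero (by simpa only [ne_eq, Submodule.zero_eq_bot, Ideal.span_singleton_eq_bot,
        sub_eq_zero] using hne) hI
    refine ⟨coset x.1 (Ideal.span {x.1 - -x.1} * I), coset (-x.1) (Ideal.span {x.1 - -x.1} * I),
      isOpen_coset hne0 ?_, isOpen_coset hne0 ?_, self_mem_coset _ _,
      self_mem_coset (⟨-x.1, neg_ne_zero.2 x.2⟩ : GolombSpace R) _, ?_⟩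
    · rw [Ideal.span_singleton_eq_top.2 hx, top_sup_eq]
    · rw [Ideal.span_singleton_eq_top.2 hx.neg, top_sup_eq]
    · rintro z ⟨hz, hz'⟩
      refine closure_mono hsub (mem_closure_coset_of_forall_prime hI fun P hP hle => ?_)
      exact mem_of_mem_closure_of_mem_closure hne hne0 hne0 le_rfl le_rfl hz hz' hP hle

/-- For small neighbourhoods of a unit `e` and of `x`, the common points of the closures lie in any
given prime that does not contain `x`, whereas for a prime `P` that contains `x` there always are
common points outside `P`. Hence the filter generated
by these intersections decreases as the set of primes containing `x` grows. -/
theorem closureLE_iff {e x y : GolombSpace R} (he : IsUnit e.1) (hx : x ≠ e) (hy : y ≠ e) :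
    ClosureLE e y x ↔ RadDvd y.1 x.1 := by
  constructor
  · intro H P hP hyP
    by_contra hxP
    have hP0 : P ≠ ⊥ := fun h => y.2 (by simpa [h] using hyP)
    have hPm := hP.isMaximal hP0
    have hex : e.1 ≠ x.1 := fun h => hx (Subtype.ext h.symm)
    have hne0 : Ideal.span {e.1 - x.1} * P ≠ ⊥ :=
      mul_ne_zero (by simpa [sub_eq_zero] using hex) hP0
    have hct : ∀ I : Ideal R, Ideal.span {e.1} ⊔ I = ⊤ := fun I => by
      rw [Ideal.span_singleton_eq_top.2 he, top_sup_eq]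
    have hcx : Ideal.span {x.1} ⊔ Ideal.span {e.1 - x.1} * P = ⊤ := by
      refine span_sup_mul_eq_top ?_ (by simpa using span_sup_pow_eq_top hPm hxP 1)
      rw [span_sup_eq_top_iff]
      intro M hM hle hxM
      have := hle (Ideal.mem_span_singleton_self _)
      exact hM.ne_top (Ideal.eq_top_of_isUnit_mem _ (by simpa using add_mem this hxM) he)
    obtain ⟨U', V', hU', hV', heU', hyV', hsub⟩ := H _ _ (isOpen_coset hne0 (hct _))
      (isOpen_coset hne0 hcx) (self_mem_coset _ _) (self_mem_coset _ _)
    obtain ⟨I, hI, hcI, hIU⟩ := exists_coset_subset hU' heU'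
    obtain ⟨J, hJ, hcJ, hJV⟩ := exists_coset_subset hV' hyV'
    obtain ⟨n, I', hI', rfl⟩ := exists_eq_pow_mul hP hP0 hI
    have hIJ : ¬ I' * J ≤ P := fun h => (hP.mul_le.1 h).elim hI'
      (not_le_of_span_sup_eq_top hPm hcJ hyP)
    obtain ⟨z, hz0, hze, hzI⟩ := exists_ne_zero_sub_mem_pow hP hP0 hIJ e.1 (n + 1)
    have hzU : (⟨z, hz0⟩ : GolombSpace R) ∈ closure (coset e.1 (P ^ n * I')) :=
      mem_closure_coset_mul (pow_ne_zero _ hP0) (right_ne_zero_of_mul hI)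
        (Ideal.pow_le_pow_right (by omega) hze) (mem_left_of_mem_mul hzI)
    have hzV : (⟨z, hz0⟩ : GolombSpace R) ∈ closure (coset y.1 J) :=
      mem_closure_coset_of_forall_prime hJ fun Q _ hle => hle (mem_right_of_mem_mul hzI)
    obtain ⟨h1, h2⟩ := hsub ⟨closure_mono hIU hzU, closure_mono hJV hzV⟩
    have hzP : z ∈ P :=
      mem_of_mem_closure_of_mem_closure hex hne0 hne0 le_rfl le_rfl h1 h2 hPm le_rfl
    refine hP.ne_top (Ideal.eq_top_of_isUnit_mem _ ?_ he)
    simpa using sub_mem hzP (Ideal.pow_le_self (by omega) hze)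
  · intro H U V hU hV heU hxV
    obtain ⟨I, hI, hcI, hIU⟩ := exists_coset_subset hU heU
    obtain ⟨J, hJ, hcJ, hJV⟩ := exists_coset_subset hV hxV
    have hey : e.1 ≠ y.1 := fun h => hy (Subtype.ext h.symm)
    have hs : Ideal.span {e.1 - y.1} ≠ ⊥ := by simpa [sub_eq_zero] using hey
    have hJ0 : Ideal.span {e.1 - y.1} * J ≠ ⊥ := mul_ne_zero hs hJ
    have hI0 : Ideal.span {e.1 - y.1} * J * I ≠ ⊥ := mul_ne_zero hJ0 hI
    refine ⟨coset e.1 (Ideal.span {e.1 - y.1} * J * I), coset y.1 (Ideal.span {e.1 - y.1} * J),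
      isOpen_coset hI0 ?_, isOpen_coset hJ0 ?_, self_mem_coset _ _, self_mem_coset _ _, ?_⟩
    · rw [Ideal.span_singleton_eq_top.2 he, top_sup_eq]
    · -- `e - y` is coprime to `y` because `e` is a unit; `J` is because `y` has fewer primes than `x`.
      refine span_sup_mul_eq_top ?_ ?_
      · rw [span_sup_eq_top_iff]
        intro M hM hle hyM
        have := hle (Ideal.mem_span_singleton_self _)
        exact hM.ne_top (Ideal.eq_top_of_isUnit_mem _ (by simpa using add_mem this hyM) he)
      · rw [span_sup_eq_top_iff] at hcJ ⊢
        exact fun P hP hle hyP => hcJ P hP hle (H P hP.isPrime hyP)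
    · rintro z ⟨hz, hz'⟩
      refine ⟨closure_mono (Set.Subset.trans ?_ hIU) hz, closure_mono hJV
        (mem_closure_coset_of_forall_prime hJ fun P hP hle => ?_)⟩
      · exact fun u hu => mem_right_of_mem_mul hu
      · exact mem_of_mem_closure_of_mem_closure hey hI0 hJ0 Ideal.mul_le_left le_rfl hz hz' hP hle

/-- Within the set of points outside a prime `Q`, relatively clopen sets are `Q`-adically open. -/
theorem coset_pow_subset_of_isOpen {Q : Ideal R} (hQ : Q.IsPrime) (hQ0 : Q ≠ ⊥)
    {A B : Set (GolombSpace R)} (hA : IsOpen A) (hB : IsOpen B) (hAB : Disjoint A B)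
    (hU : ∀ x : GolombSpace R, x ∈ A ∨ x ∈ B ↔ x.1 ∉ Q) {w : GolombSpace R} (hw : w ∈ A) :
    ∃ n, coset w.1 (Q ^ (n + 1)) ⊆ A := by
  have key : ∀ {A : Set (GolombSpace R)}, IsOpen A → ∀ w ∈ A, ∃ (n : ℕ) (J : Ideal R), ¬ J ≤ Q ∧
      ∀ y : GolombSpace R, y.1 - w.1 ∈ Q ^ n → y.1 ∈ J → y ∈ closure A := by
    intro A hA w hw
    obtain ⟨I, hI, hc, hsub⟩ := exists_coset_subset hA hw
    obtain ⟨n, J, hJ, rfl⟩ := exists_eq_pow_mul hQ hQ0 hI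
    exact ⟨n, J, hJ, fun y h1 h2 => closure_mono hsub
      (mem_closure_coset_mul (pow_ne_zero _ hQ0) (right_ne_zero_of_mul hI) h1 h2)⟩
  obtain ⟨n, J, hJ, H⟩ := key hA w hw
  refine ⟨n, fun w' hw' => ?_⟩
  have hwQ : w.1 ∉ Q := (hU w).1 (Or.inl hw)
  have hw'w : w'.1 - w.1 ∈ Q ^ (n + 1) := hw'
  have hw'Q : w'.1 ∉ Q := fun h => hwQ (by
    simpa using sub_mem h (Ideal.pow_le_self (by omega) hw'w))
  by_contra hA'
  have hB' : w' ∈ B := ((hU w').2 hw'Q).resolve_left hA'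
  obtain ⟨n', J', hJ', H'⟩ := key hB w' hB'
  have hJJ : ¬ J * J' ≤ Q := fun h => (hQ.mul_le.1 h).elim hJ hJ'
  obtain ⟨z, hz0, hzw, hzJ⟩ := exists_ne_zero_sub_mem_pow hQ hQ0 hJJ w'.1 (n + n' + 1)
  have hzQ : z ∉ Q := fun h => hw'Q (by
    simpa using sub_mem h (Ideal.pow_le_self (by omega) hzw))
  have h1 : (⟨z, hz0⟩ : GolombSpace R) ∈ closure A := by
    refine H _ ?_ (mem_left_of_mem_mul hzJ)
    simpa using add_mem (Ideal.pow_le_pow_right (show n ≤ n + n' + 1 by omega) hzw)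
      (Ideal.pow_le_pow_right (Nat.le_succ n) hw'w)
  have h2 : (⟨z, hz0⟩ : GolombSpace R) ∈ closure B :=
    H' _ (Ideal.pow_le_pow_right (by omega) hzw) (mem_right_of_mem_mul hzJ)
  rcases (hU ⟨z, hz0⟩).2 hzQ with h | h
  · obtain ⟨u, hu, hu'⟩ := mem_closure_iff (X := GolombSpace R).1 h2 A hA h
    exact Set.disjoint_left.1 hAB hu hu'
  · obtain ⟨u, hu, hu'⟩ := mem_closure_iff (X := GolombSpace R).1 h1 B hB h
    exact Set.disjoint_left.1 hAB hu' hu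

/-- `Q`-adically open sets of points outside the maximal ideal `Q` are open in the Golomb space. -/
lemma isOpen_of_coset_pow_subset {Q : Ideal R} (hQ : Q.IsPrime) (hQ0 : Q ≠ ⊥)
    {A : Set (GolombSpace R)} (hA : ∀ x ∈ A, x.1 ∉ Q ∧ ∃ n, coset x.1 (Q ^ n) ⊆ A) : IsOpen A := by
  rw [isOpen_iff_coset]
  intro x hx
  obtain ⟨hxQ, n, hn⟩ := hA x hx
  exact ⟨Q ^ n, pow_ne_zero n hQ0, span_sup_pow_eq_top (hQ.isMaximal hQ0) hxQ n, hn⟩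

end Invariants

end GolombSpace

namespace GolombSpace

/-! ### Homeomorphisms and prime ideals -/

section Homeomorph

variable {R S : Type*} [CommRing R] [IsDedekindDomain R] [CommRing S] [IsDedekindDomain S]

theorem isUnit_map_iff (hR : (2 : R) ≠ 0) (hS : (2 : S) ≠ 0) (h : GolombSpace R ≃ₜ GolombSpace S)
    (x : GolombSpace R) : IsUnit (h x).1 ↔ IsUnit x.1 := by
  rw [← isUnitPoint_iff hR, ← isUnitPoint_iff hS]
  exact ⟨fun H => by simpa using H.map h.symm, fun H => H.map h⟩

theorem radDvd_map_iff (hR : (2 : R) ≠ 0) (hS : (2 : S) ≠ 0) (h : GolombSpace R ≃ₜ GolombSpace S)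
    {x y : GolombSpace R} (hx : ¬ IsUnit x.1) (hy : ¬ IsUnit y.1) :
    RadDvd (h y).1 (h x).1 ↔ RadDvd y.1 x.1 := by
  obtain ⟨e, he⟩ : ∃ e : GolombSpace R, IsUnit e.1 := ⟨⟨1, one_ne_zero⟩, isUnit_one⟩
  have hne : ∀ {z : GolombSpace R}, ¬ IsUnit z.1 → z ≠ e := fun hz hz' => hz (hz' ▸ he)
  rw [← closureLE_iff he (hne hx) (hne hy), ← closureLE_iff
    ((isUnit_map_iff hR hS h _).2 he) (h.injective.ne (hne hx)) (h.injective.ne (hne hy))]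
  refine ⟨fun H => ?_, fun H => H.map h⟩
  have := H.map h.symm
  rwa [h.symm_apply_apply, h.symm_apply_apply, h.symm_apply_apply] at this

end Homeomorph

section PrimeCorrespondence

lemma radDvd_prime_iff {S : Type*} [CommRing S] {q : S} (hq : Prime q) {n : S} :
    RadDvd q n ↔ q ∣ n := by
  constructor
  · intro H
    rw [← Ideal.mem_span_singleton]
    exact H _ ((Ideal.span_singleton_prime hq.ne_zero).2 hq) (Ideal.mem_span_singleton_self q)
  · exact fun H P _ hqP => P.mem_of_dvd H hqP

lemma not_isUnit_of_mem {R : Type*} [CommRing R] {P : Ideal R} (hP : P.IsPrime) {x : R}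
    (hx : x ∈ P) : ¬ IsUnit x :=
  fun h => hP.ne_top (Ideal.eq_top_of_isUnit_mem _ hx h)

variable {R S : Type*} [CommRing R] [IsDedekindDomain R] [CommRing S] [IsDedekindDomain S]

/-- If a point `b` corresponds to a prime element under a homeomorphism of Golomb spaces, then
`b` lies in a single prime ideal. Otherwise some product `x₁ * x₂` would lie in all the primes that
contain `b` with neither factor doing so, whereas a prime element divides a factor of each product
that it divides. -/
theorem eq_of_map_prime (hR : (2 : R) ≠ 0) (hS : (2 : S) ≠ 0) (h : GolombSpace R ≃ₜ GolombSpace S)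
    {b : GolombSpace R} (hb : Prime (h b).1) {P₁ P₂ : Ideal R} (hP₁ : P₁.IsPrime)
    (hP₂ : P₂.IsPrime) (h₁ : b.1 ∈ P₁) (h₂ : b.1 ∈ P₂) : P₁ = P₂ := by
  by_contra hne
  have h10 : P₁ ≠ ⊥ := fun H => b.2 (by simpa [H] using h₁)
  have h20 : P₂ ≠ ⊥ := fun H => b.2 (by simpa [H] using h₂)
  have hm₁ := hP₁.isMaximal h10
  have hm₂ := hP₂.isMaximal h20
  obtain ⟨k, B, hB, hbB⟩ := exists_eq_pow_mul (I := Ideal.span {b.1}) hP₁ h10 (by simpa using b.2)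
  have hk : ¬ P₁ ^ k ≤ P₂ := fun H =>
    hne (hm₁.eq_of_le hP₂.ne_top (hP₂.le_of_pow_le H))
  have hk0 : k ≠ 0 := by
    rintro rfl
    rw [pow_zero, one_mul] at hbB
    exact hB (hbB ▸ (Ideal.span_singleton_le_iff_mem _).2 h₁)
  have hB₂ : B ≤ P₂ := by
    have : P₁ ^ k * B ≤ P₂ := hbB ▸ (Ideal.span_singleton_le_iff_mem _).2 h₂
    exact (hP₂.mul_le.1 this).resolve_left hk
  obtain ⟨x₁, hx₁, hx₁'⟩ := SetLike.not_le_iff_exists.1 hk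
  obtain ⟨x₂, hx₂, hx₂'⟩ := SetLike.not_le_iff_exists.1 hB
  have hx₁P : x₁ ∈ P₁ := Ideal.pow_le_self hk0 hx₁
  have hx₂P : x₂ ∈ P₂ := hB₂ hx₂
  obtain ⟨X₁, rfl⟩ : ∃ X : GolombSpace R, X.1 = x₁ :=
    ⟨⟨x₁, fun H => hx₁' (H ▸ zero_mem _)⟩, rfl⟩
  obtain ⟨X₂, rfl⟩ : ∃ X : GolombSpace R, X.1 = x₂ :=
    ⟨⟨x₂, fun H => hx₂' (H ▸ zero_mem _)⟩, rfl⟩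
  obtain ⟨Y, hY⟩ : ∃ Y : GolombSpace R, Y.1 = X₁.1 * X₂.1 :=
    ⟨⟨X₁.1 * X₂.1, mul_ne_zero X₁.2 X₂.2⟩, rfl⟩
  obtain ⟨N, hN⟩ : ∃ N : GolombSpace R, (h N).1 = (h X₁).1 * (h X₂).1 :=
    ⟨h.symm ⟨(h X₁).1 * (h X₂).1, mul_ne_zero (h X₁).2 (h X₂).2⟩,
      congrArg Subtype.val (h.apply_symm_apply _)⟩
  have ub := not_isUnit_of_mem hP₁ h₁
  have u₁ := not_isUnit_of_mem hP₁ hx₁P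
  have u₂ := not_isUnit_of_mem hP₂ hx₂P
  have uY : ¬ IsUnit Y.1 := fun H => u₁ (isUnit_of_mul_isUnit_left (hY ▸ H))
  have uN : ¬ IsUnit N.1 := by
    rw [← isUnit_map_iff hR hS h, hN]
    exact fun H => u₁ ((isUnit_map_iff hR hS h _).1 (isUnit_of_mul_isUnit_left H))
  have hbY : RadDvd b.1 Y.1 := by
    intro P hP hbP
    have : Y.1 ∈ Ideal.span {b.1} := by
      rw [hbB, hY]
      exact Ideal.mul_mem_mul hx₁ hx₂
    exact (Ideal.span_singleton_le_iff_mem _).2 hbP this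
  have hYN : RadDvd Y.1 N.1 := by
    have d₁ : RadDvd X₁.1 N.1 := (radDvd_map_iff hR hS h uN u₁).1
      fun P _ H => hN ▸ P.mul_mem_right _ H
    have d₂ : RadDvd X₂.1 N.1 := (radDvd_map_iff hR hS h uN u₂).1
      fun P _ H => hN ▸ P.mul_mem_left _ H
    intro P hP H
    rw [hY] at H
    exact (hP.mem_or_mem H).elim (d₁ P hP) (d₂ P hP)
  have hbN : RadDvd b.1 N.1 := fun P hP H => hYN P hP (hbY P hP H)
  have hdvd : (h b).1 ∣ (h X₁).1 * (h X₂).1 :=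
    hN ▸ (radDvd_prime_iff hb).1 ((radDvd_map_iff hR hS h uN ub).2 hbN)
  rcases hb.dvd_or_dvd hdvd with H | H
  · exact hx₁' ((radDvd_map_iff hR hS h u₁ ub).1 ((radDvd_prime_iff hb).2 H) P₂ hP₂ h₂)
  · exact hx₂' ((radDvd_map_iff hR hS h u₂ ub).1 ((radDvd_prime_iff hb).2 H) P₁ hP₁ h₁)

/-- If `h b` is a prime element, then membership in the prime ideal `Q` containing `b` corresponds
to divisibility by `h b`. -/
theorem mem_iff_map_prime_dvd (hR : (2 : R) ≠ 0) (hS : (2 : S) ≠ 0)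
    (h : GolombSpace R ≃ₜ GolombSpace S) {b : GolombSpace R} (hb : Prime (h b).1) {Q : Ideal R}
    (hQ : Q.IsPrime) (hbQ : b.1 ∈ Q) (x : GolombSpace R) : x.1 ∈ Q ↔ (h b).1 ∣ (h x).1 := by
  have ub := not_isUnit_of_mem hQ hbQ
  by_cases hx : IsUnit x.1
  · refine iff_of_false (fun H => not_isUnit_of_mem hQ H hx) (fun H => hb.not_isUnit ?_)
    exact isUnit_of_dvd_unit H ((isUnit_map_iff hR hS h x).2 hx)
  · rw [← radDvd_prime_iff hb, radDvd_map_iff hR hS h hx ub]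
    refine ⟨fun H P hP hbP => ?_, fun H => H Q hQ hbQ⟩
    rwa [← eq_of_map_prime hR hS h hb hQ hP hbQ hbP]

/-- Every nonzero prime ideal corresponds to a prime element of the unique factorization domain `S`.
This is proved by induction on the factorization of the image of a point of `Q`: if
`h X = h C * h D`, then the primes containing `X` are among those containing `C * D`. -/
theorem exists_mem_map_prime [UniqueFactorizationMonoid S] (hR : (2 : R) ≠ 0) (hS : (2 : S) ≠ 0)
    (h : GolombSpace R ≃ₜ GolombSpace S) {Q : Ideal R} (hQ : Q.IsPrime) (hQ0 : Q ≠ ⊥) :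
    ∃ b : GolombSpace R, Prime (h b).1 ∧ b.1 ∈ Q := by
  suffices key : ∀ n : S, ∀ X : GolombSpace R, (h X).1 = n → X.1 ∈ Q →
      ∃ b : GolombSpace R, Prime (h b).1 ∧ b.1 ∈ Q by
    obtain ⟨x, hxQ, hx0⟩ := Submodule.exists_mem_ne_zero_of_ne_bot hQ0
    exact key _ ⟨x, hx0⟩ rfl hxQ
  intro n
  induction n using UniqueFactorizationMonoid.induction_on_prime with
  | h₁ => exact fun X hX => absurd hX (h X).2
  | h₂ n hn =>
    exact fun X hX hXQ => absurd ((isUnit_map_iff hR hS h X).1 (hX ▸ hn)) (not_isUnit_of_mem hQ hXQ)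
  | h₃ a p ha hp ih =>
    intro X hX hXQ
    by_cases ua : IsUnit a
    · exact ⟨X, hX ▸ (associated_mul_unit_left p a ua).symm.prime hp, hXQ⟩
    have hsurj : ∀ s : S, s ≠ 0 → ∃ c : GolombSpace R, (h c).1 = s := fun s hs =>
      ⟨h.symm ⟨s, hs⟩, congrArg Subtype.val (h.apply_symm_apply _)⟩
    obtain ⟨C, rfl⟩ := hsurj p hp.ne_zero
    obtain ⟨D, rfl⟩ := hsurj a ha
    obtain ⟨Y, hY⟩ : ∃ Y : GolombSpace R, Y.1 = C.1 * D.1 :=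
      ⟨⟨C.1 * D.1, mul_ne_zero C.2 D.2⟩, rfl⟩
    have uC : ¬ IsUnit C.1 := fun H => hp.not_isUnit ((isUnit_map_iff hR hS h C).2 H)
    have uD : ¬ IsUnit D.1 := fun H => ua ((isUnit_map_iff hR hS h D).2 H)
    have uX := not_isUnit_of_mem hQ hXQ
    have uY : ¬ IsUnit Y.1 := fun H => uC (isUnit_of_mul_isUnit_left (hY ▸ H))
    have dC : RadDvd (h C).1 (h Y).1 := (radDvd_map_iff hR hS h uY uC).2
      fun P _ H => hY ▸ P.mul_mem_right _ H
    have dD : RadDvd (h D).1 (h Y).1 := (radDvd_map_iff hR hS h uY uD).2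
      fun P _ H => hY ▸ P.mul_mem_left _ H
    have dX : RadDvd X.1 Y.1 := (radDvd_map_iff hR hS h uY uX).1 fun P hP H => by
      rw [hX] at H
      exact (hP.mem_or_mem H).elim (dC P hP) (dD P hP)
    have hYQ := dX Q hQ hXQ
    rw [hY] at hYQ
    exact (hQ.mem_or_mem hYQ).elim (fun H => ⟨C, hp, H⟩) (ih D rfl)

/-! ### Homeomorphisms and adic topologies -/

lemma notMem_of_mem_coset_pow {R : Type*} [CommRing R] {Q : Ideal R} {w : R} (hw : w ∉ Q)
    {n : ℕ} {x : GolombSpace R}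
    (hx : x ∈ coset w (Q ^ (n + 1))) : x.1 ∉ Q := fun H =>
  hw (by simpa using sub_mem H (Ideal.pow_le_self n.succ_ne_zero hx))

lemma isOpen_compl_coset_pow {Q : Ideal R} (hQ : Q.IsPrime) (hQ0 : Q ≠ ⊥) (w : R) (n : ℕ) :
    IsOpen {x : GolombSpace R | x.1 ∉ Q ∧ x ∉ coset w (Q ^ n)} := by
  refine isOpen_of_coset_pow_subset hQ hQ0 fun x hx =>
    ⟨hx.1, n + 1, fun y hy => ⟨fun H => ?_, fun H => ?_⟩⟩
  · exact hx.1 (by simpa using sub_mem H (Ideal.pow_le_self n.succ_ne_zero hy))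
  · refine hx.2 ?_
    have h1 : y.1 - x.1 ∈ Q ^ n := Ideal.pow_le_pow_right (Nat.le_succ n) hy
    have h2 : y.1 - w ∈ Q ^ n := H
    change x.1 - w ∈ Q ^ n
    simpa using sub_mem h2 h1

lemma isOpen_coset_pow {Q : Ideal R} (hQ : Q.IsPrime) (hQ0 : Q ≠ ⊥) {w : R} (hw : w ∉ Q) (n : ℕ) :
    IsOpen (coset w (Q ^ n)) :=
  isOpen_coset (pow_ne_zero n hQ0) (span_sup_pow_eq_top (hQ.isMaximal hQ0) hw n)

/-- A homeomorphism that matches the primes `Q` and `Q'` is continuous from the `Q`-adic to the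
`Q'`-adic topology, away from these primes. -/
theorem exists_coset_pow_subset_preimage (h : GolombSpace R ≃ₜ GolombSpace S) {Q : Ideal R}
    (hQ : Q.IsPrime) (hQ0 : Q ≠ ⊥) {Q' : Ideal S} (hQ' : Q'.IsPrime) (hQ'0 : Q' ≠ ⊥)
    (hQQ' : ∀ x, x.1 ∈ Q ↔ (h x).1 ∈ Q') {w : GolombSpace R} (hw : w.1 ∉ Q) (n : ℕ) :
    ∃ m, coset w.1 (Q ^ (m + 1)) ⊆ h ⁻¹' coset (h w).1 (Q' ^ (n + 1)) := by
  have hw' : (h w).1 ∉ Q' := fun H => hw ((hQQ' w).2 H)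
  refine coset_pow_subset_of_isOpen hQ hQ0
    ((isOpen_coset_pow hQ' hQ'0 hw' (n + 1)).preimage h.continuous)
    ((isOpen_compl_coset_pow hQ' hQ'0 (h w).1 (n + 1)).preimage h.continuous)
    (Set.disjoint_left.2 fun x h1 h2 => h2.2 h1) (fun x => ?_)
    (Set.mem_preimage.2 (self_mem_coset (h w) _))
  rw [hQQ']
  constructor
  · rintro (H | H)
    · exact notMem_of_mem_coset_pow hw' H
    · exact H.1
  · intro H
    by_cases hx : h x ∈ coset (h w).1 (Q' ^ (n + 1))
    · exact Or.inl hx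
    · exact Or.inr ⟨H, hx⟩

/-- A homeomorphism that matches the primes `Q` and `Q'` transports the property of being
`Q'`-adically dense in a neighbourhood of a point outside `Q'`. -/
theorem exists_dense_of_dense (h : GolombSpace R ≃ₜ GolombSpace S) {Q : Ideal R}
    (hQ : Q.IsPrime) (hQ0 : Q ≠ ⊥) {Q' : Ideal S} (hQ' : Q'.IsPrime) (hQ'0 : Q' ≠ ⊥)
    (hQQ' : ∀ x, x.1 ∈ Q ↔ (h x).1 ∈ Q') (E : Set (GolombSpace S)) {w : GolombSpace S}
    (hw : w.1 ∉ Q') {n : ℕ}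
    (hE : ∀ y ∈ coset w.1 (Q' ^ (n + 1)), ∀ m, (E ∩ coset y.1 (Q' ^ m)).Nonempty) :
    ∃ (x₀ : GolombSpace R) (k : ℕ), x₀.1 ∉ Q ∧ ∀ y ∈ coset x₀.1 (Q ^ (k + 1)), ∀ m,
      ∃ z : GolombSpace R, h z ∈ E ∧ z.1 - y.1 ∈ Q ^ m := by
  have hx₀ : (h.symm w).1 ∉ Q := fun H => hw (by simpa using (hQQ' _).1 H)
  obtain ⟨k, hk⟩ := exists_coset_pow_subset_preimage h hQ hQ0 hQ' hQ'0 hQQ' hx₀ n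
  refine ⟨h.symm w, k, hx₀, fun y hy m => ?_⟩
  have hyw : h y ∈ coset w.1 (Q' ^ (n + 1)) := by simpa using hk hy
  have hyQ : (h y).1 ∉ Q' := notMem_of_mem_coset_pow hw hyw
  obtain ⟨l, hl⟩ := exists_coset_pow_subset_preimage h.symm hQ' hQ'0 hQ hQ0
    (fun x => by rw [hQQ', h.apply_symm_apply]) hyQ m
  obtain ⟨z, hzE, hz⟩ := hE (h y) hyw (l + 1)
  have hz' : h.symm z ∈ coset (h.symm (h y)).1 (Q ^ (m + 1)) := hl hz
  rw [h.symm_apply_apply] at hz'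
  exact ⟨h.symm z, by simpa using hzE, Ideal.pow_le_pow_right (Nat.le_succ m) hz'⟩

end PrimeCorrespondence

end GolombSpace

/-! ### Powers of a prime are `q`-adically dense near `1` in the integers -/

section Integers

/-- If `g = 1 + q ^ a * x` with `q ∤ x` (and `a ≥ 2` when `q = 2`), then the powers of `g` are dense
in `1 + q ^ a ℤ` for the `q`-adic topology: if `y - g ^ k` is divisible by `q ^ i * q ^ a`, then
multiplying `g ^ k` by a suitable power of `g ^ q ^ i` improves the approximation. -/
theorem exists_pow_sub_dvd {q : ℕ} (hq : q.Prime) {a : ℕ} (ha : a + 2 ≤ a * q) {x : ℤ}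
    (hx : ¬ (q : ℤ) ∣ x) {y : ℤ} (hy : (q : ℤ) ^ a ∣ y - 1) (i : ℕ) :
    ∃ k : ℕ, (q : ℤ) ^ (i + a) ∣ y - (1 + (q : ℤ) ^ a * x) ^ k := by
  have hqp : Prime (q : ℤ) := Nat.prime_iff_prime_int.1 hq
  have ha0 : a ≠ 0 := by rintro rfl; omega
  induction i with
  | zero => exact ⟨0, by simpa using hy⟩
  | succ i ih =>
    obtain ⟨k, t, ht⟩ := ih
    obtain ⟨z, hz⟩ := ZMod.exists_one_add_mul_pow_prime_pow_eq (u := (q : ℤ) ^ a) (v := (q : ℤ)) hq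
      (dvd_pow_self _ ha0) (by
        rw [← pow_succ', ← pow_succ, ← pow_mul]
        exact pow_dvd_pow _ ha) x i
    have hg : ¬ (q : ℤ) ∣ (1 + (q : ℤ) ^ a * x) ^ k := fun H => by
      have h1 := hqp.dvd_of_dvd_pow H
      have h2 : (q : ℤ) ∣ (q : ℤ) ^ a * x := Dvd.dvd.mul_right (dvd_pow_self _ ha0) _
      exact hqp.not_dvd_one ((Int.dvd_add_left h2).1 h1)
    have hcop : IsCoprime ((1 + (q : ℤ) ^ a * x) ^ k * x) (q : ℤ) := by
      rw [isCoprime_comm, hqp.coprime_iff_not_dvd]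
      exact fun H => (hqp.dvd_or_dvd H).elim hg hx
    obtain ⟨c, d, hcd⟩ := hcop
    -- the exponent is `k + q ^ i * j`, where `j` solves `g ^ k * x * j ≡ t` modulo `q`
    obtain ⟨j, hj⟩ : ∃ j : ℕ, (q : ℤ) ∣ (j : ℤ) - t * c := by
      refine ⟨((t * c) % q).toNat, ?_⟩
      rw [Int.toNat_of_nonneg (Int.emod_nonneg _ hqp.ne_zero)]
      exact (Int.mod_modEq _ _).symm.dvd
    obtain ⟨s, hs⟩ := hj
    have hpow : ∃ r, (1 + (q : ℤ) ^ i * (q : ℤ) ^ a * (x + q * z)) ^ j =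
        1 + j * ((q : ℤ) ^ i * (q : ℤ) ^ a * (x + q * z)) +
          ((q : ℤ) ^ i * (q : ℤ) ^ a * (x + q * z)) ^ 2 * r := by
      generalize (q : ℤ) ^ i * (q : ℤ) ^ a * (x + q * z) = w
      clear hs
      induction j with
      | zero => exact ⟨0, by simp⟩
      | succ j ihj =>
        obtain ⟨r, hr⟩ := ihj
        exact ⟨j + r + r * w, by rw [pow_succ, hr]; push_cast; ring⟩
    obtain ⟨r, hr⟩ := hpow
    refine ⟨k + q ^ i * j, ?_⟩
    rw [pow_add _ k, pow_mul, hz, hr]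
    generalize (1 + (q : ℤ) ^ a * x) ^ k = G at hcd ht
    obtain ⟨b, rfl⟩ : ∃ b, a = b + 1 := ⟨a - 1, by omega⟩
    refine ⟨t * d - G * x * s - G * j * z - G * (q : ℤ) ^ (i + b) * (x + q * z) ^ 2 * r, ?_⟩
    linear_combination ht - (q : ℤ) ^ (i + (b + 1)) * G * x * hs - (q : ℤ) ^ (i + (b + 1)) * t * hcd

/-- The powers of a prime `p ≠ q` are `q`-adically dense in a neighbourhood of `1` in `ℤ`. -/
theorem exists_prime_pow_sub_dvd {p q : ℕ} (hp : p.Prime) (hq : q.Prime) (hpq : p ≠ q) :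
    ∃ n : ℕ, ∀ y : ℤ, (q : ℤ) ^ (n + 1) ∣ y - 1 → ∀ m : ℕ,
      ∃ k : ℕ, (q : ℤ) ^ m ∣ y - (p : ℤ) ^ k := by
  have hqp : Prime (q : ℤ) := Nat.prime_iff_prime_int.1 hq
  have hp' : Prime (p : ℤ) := Nat.prime_iff_prime_int.1 hp
  have hcop : IsCoprime (p : ℤ) (q : ℤ) :=
    Nat.isCoprime_iff_coprime.2 ((Nat.coprime_primes hp hq).2 hpq)
  -- the exponent is doubled so that `g ≡ 1` modulo `4` when `q = 2`
  obtain ⟨g, hg⟩ : ∃ g : ℤ, g = (p : ℤ) ^ (2 * (q - 1)) := ⟨_, rfl⟩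
  have hg1 : g - 1 ≠ 0 := by
    have h1 : (1 : ℤ) < p := by exact_mod_cast hp.one_lt
    have h2 : 2 * (q - 1) ≠ 0 := by have := hq.two_le; omega
    have := one_lt_pow₀ h1 h2
    omega
  have hqg : (q : ℤ) ∣ g - 1 := by
    have h1 := (Int.ModEq.pow_card_sub_one_eq_one hq hcop).pow 2
    rw [one_pow, ← pow_mul, mul_comm] at h1
    rw [hg]
    exact h1.symm.dvd
  obtain ⟨a, x, hx, e⟩ := WfDvdMonoid.max_power_factor hg1 hqp.irreducible
  have ha : a + 2 ≤ a * q := by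
    have ha0 : a ≠ 0 := by
      rintro rfl
      rw [pow_zero, one_mul] at e
      exact hx (e ▸ hqg)
    rcases hq.eq_two_or_odd' with rfl | hodd
    · have h4 : (4 : ℤ) ∣ g - 1 := by
        have hodd : ¬ (2 : ℤ) ∣ p := fun H => hqp.not_isUnit (hcop.isUnit_of_dvd' H dvd_rfl)
        obtain ⟨b, hb⟩ : ∃ b : ℤ, (p : ℤ) = 2 * b + 1 := ⟨p / 2, by omega⟩
        exact ⟨b ^ 2 + b, by rw [hg, hb]; norm_num; ring⟩
      have ha1 : a ≠ 1 := by
        rintro rfl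
        rw [pow_one] at e
        exact hx (by push_cast at e ⊢; omega)
      omega
    · have h3 : 3 ≤ q := by
        have := hq.two_le
        obtain ⟨b, rfl⟩ := hodd
        omega
      nlinarith [Nat.pos_of_ne_zero ha0]
  have ha0 : a ≠ 0 := by rintro rfl; omega
  refine ⟨a - 1, fun y hy m => ?_⟩
  rw [Nat.sub_add_cancel (Nat.pos_of_ne_zero ha0)] at hy
  obtain ⟨k, hk⟩ := exists_pow_sub_dvd hq ha hx hy m
  refine ⟨2 * (q - 1) * k, (pow_dvd_pow _ (Nat.le_add_right m a)).trans ?_⟩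
  rw [pow_mul, ← hg]
  rwa [← e, add_sub_cancel] at hk

end Integers

/-! ### Dedekind domains with units `±1` -/

section DedekindDomain

open GolombSpace

variable {R : Type*} [CommRing R] [IsDedekindDomain R]

/-- If `±1` are the only units, then the generators of the powers of a nonzero prime `P` are, up to
sign, the powers of a single element. -/
theorem exists_generator_of_pow (hu : ∀ u : R, IsUnit u → u = 1 ∨ u = -1) {P : Ideal R}
    (hP : P.IsPrime) (hP0 : P ≠ ⊥) :
    ∃ π : R, (∀ Q : Ideal R, Q.IsPrime → Q ≠ P → π ∉ Q) ∧
      ∀ x m, Ideal.span {x} = P ^ m → ∃ k : ℕ, x = π ^ k ∨ x = -π ^ k := by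
  classical
  have hone : ∀ x : R, Ideal.span {x} = ⊤ → x = 1 ∨ x = -1 := fun x hx =>
    hu x (Ideal.span_singleton_eq_top.1 hx)
  by_cases hex : ∃ m ≠ 0, ∃ x : R, Ideal.span {x} = P ^ m
  · obtain ⟨hl0, π, hπ⟩ := Nat.find_spec hex
    have hmin := fun m => Nat.find_min hex (m := m)
    generalize Nat.find hex = l at hl0 hπ hmin
    refine ⟨π, fun Q hQ hne hπQ => ?_, fun x m => ?_⟩
    · have : P ≤ Q := hQ.le_of_pow_le (hπ ▸ (Ideal.span_singleton_le_iff_mem _).2 hπQ)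
      exact hne ((hP.isMaximal hP0).eq_of_le hQ.ne_top this).symm
    · induction m using Nat.strong_induction_on generalizing x with
      | _ m ih =>
        intro hx
        rcases eq_or_ne m 0 with rfl | hm0
        · exact ⟨0, by simpa using hone x (by simpa using hx)⟩
        by_cases hlm : m < l
        · exact absurd ⟨hm0, x, hx⟩ (hmin m hlm)
        have hdvd : π ∣ x := by
          rw [← Ideal.span_singleton_le_span_singleton, hx, hπ]
          exact Ideal.pow_le_pow_right (by omega)
        obtain ⟨c, rfl⟩ := hdvd
        have hc : Ideal.span {c} = P ^ (m - l) := by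
          rw [← Ideal.span_singleton_mul_span_singleton, hπ,
            ← Nat.add_sub_cancel' (not_lt.1 hlm), pow_add] at hx
          exact mul_left_cancel₀ (pow_ne_zero l hP0) (by simpa using hx)
        obtain ⟨k, hk | hk⟩ := ih (m - l) (by omega) c hc
        · exact ⟨k + 1, Or.inl (by rw [hk]; ring)⟩
        · exact ⟨k + 1, Or.inr (by rw [hk]; ring)⟩
  · refine ⟨1, fun Q hQ _ h1 => hQ.ne_top ((Ideal.eq_top_iff_one Q).2 h1), fun x m hx => ⟨0, ?_⟩⟩
    have hm : m = 0 := by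
      by_contra hm
      exact hex ⟨m, hm, x, hx⟩
    subst hm
    simpa using hone x (by simpa using hx)

/-- An element lying in no prime other than `P` generates a power of `P`. -/
lemma span_eq_pow_of_forall_prime {P : Ideal R} (hP : P.IsPrime) (hP0 : P ≠ ⊥) {x : R} (hx : x ≠ 0)
    (h : ∀ Q : Ideal R, Q.IsPrime → x ∈ Q → Q = P) : ∃ m, Ideal.span {x} = P ^ m := by
  obtain ⟨m, J, hJ, e⟩ := exists_eq_pow_mul (I := Ideal.span {x}) hP hP0 (by simpa using hx)
  have hJt : J = ⊤ := by
    by_contra hne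
    obtain ⟨M, hM, hle⟩ := Ideal.exists_le_maximal J hne
    have hxM : x ∈ M := by
      have := Ideal.mem_span_singleton_self x
      rw [e] at this
      exact hle (mem_right_of_mem_mul this)
    exact hJ (h M hM.isPrime hxM ▸ hle)
  exact ⟨m, by rw [e, hJt, Ideal.mul_top]⟩

end DedekindDomain

/-! ### Approximation by powers of one element excludes ramification -/

section Ramified

open GolombSpace

/-- A cyclic group, finite or not, has at most `N` elements killed by `N`. -/
lemma exists_finset_zpow {G : Type*} [CommGroup G] (g : G) {N : ℕ} (hN : N ≠ 0) :
    ∃ S : Finset G, S.card ≤ N ∧ ∀ j : ℤ, (g ^ j) ^ N = 1 → g ^ j ∈ S := by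
  classical
  let H : AddSubgroup ℤ :=
    { carrier := {j | (g ^ j) ^ N = 1}
      zero_mem' := by simp
      add_mem' := fun {a b} ha hb => by
        have ha' : (g ^ a) ^ N = 1 := ha
        have hb' : (g ^ b) ^ N = 1 := hb
        change (g ^ (a + b)) ^ N = 1
        rw [zpow_add, mul_pow, ha', hb', one_mul]
      neg_mem' := fun {a} ha => by
        have ha' : (g ^ a) ^ N = 1 := ha
        change (g ^ (-a)) ^ N = 1
        rw [zpow_neg, inv_pow, ha', inv_one] }
  obtain ⟨d, hd⟩ := Int.subgroup_cyclic H
  rw [← AddSubgroup.zmultiples_eq_closure] at hd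
  have hdH : (g ^ d) ^ N = 1 := by
    have : d ∈ H := hd ▸ AddSubgroup.mem_zmultiples d
    exact this
  refine ⟨(Finset.range N).image fun i => (g ^ d) ^ i,
    Finset.card_image_le.trans (Finset.card_range N).le, fun j hj => ?_⟩
  have hjH : j ∈ H := hj
  rw [hd, Int.mem_zmultiples_iff] at hjH
  obtain ⟨a, rfl⟩ := hjH
  have hN' : (N : ℤ) ≠ 0 := by exact_mod_cast hN
  refine Finset.mem_image.2 ⟨(a % N).toNat, ?_, ?_⟩
  · have := Int.emod_lt_of_pos a (show (0 : ℤ) < N by omega)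
    have := Int.emod_nonneg a hN'
    rw [Finset.mem_range]
    omega
  · rw [← zpow_natCast, Int.toNat_of_nonneg (Int.emod_nonneg a hN'), zpow_mul]
    conv_rhs => rw [← Int.emod_add_mul_ediv a N, zpow_add, zpow_mul, zpow_natCast, hdH, one_zpow,
      mul_one]

variable {R : Type*} [CommRing R]

lemma one_add_pow_prime_sub_one_mem {Q : Ideal R} {l : ℕ} (hl : l.Prime) (hlQ : (l : R) ∈ Q ^ 2)
    {j : ℕ} (hj : 2 ≤ j) {u : R} (hu : u - 1 ∈ Q ^ j) : u ^ l - 1 ∈ Q ^ (j + 2) := by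
  obtain ⟨t, rfl⟩ : ∃ t, u = 1 + t := ⟨u - 1, by ring⟩
  rw [add_sub_cancel_left] at hu
  obtain ⟨r, hr⟩ := exists_add_pow_prime_eq hl 1 t
  have h1 : t ^ l ∈ Q ^ (j + 2) := by
    have : t ^ l ∈ Q ^ (j * l) := pow_mul Q j l ▸ Ideal.pow_mem_pow hu l
    exact Ideal.pow_le_pow_right (by nlinarith [hl.two_le]) this
  have h2 : (l : R) * t ∈ Q ^ (j + 2) := by
    rw [mul_comm, pow_add]
    exact Ideal.mul_mem_mul hu hlQ
  have e : (1 + t) ^ l - 1 = t ^ l + l * t * r := by rw [hr]; ring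
  rw [e]
  exact add_mem h1 (Ideal.mul_mem_right _ _ h2)

lemma one_add_pow_prime_pow_sub_one_mem {Q : Ideal R} {l : ℕ} (hl : l.Prime)
    (hlQ : (l : R) ∈ Q ^ 2) {j : ℕ} (hj : 2 ≤ j) {u : R} (hu : u - 1 ∈ Q ^ j) (i : ℕ) :
    u ^ (l ^ i) - 1 ∈ Q ^ (j + 2 * i) := by
  induction i with
  | zero => simpa using hu
  | succ i ih =>
    rw [pow_succ, pow_mul]
    exact one_add_pow_prime_sub_one_mem hl hlQ (le_add_right hj) ih

variable [IsDedekindDomain R]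

/-- `Q ^ n` contains at least `l ^ k` classes modulo `Q ^ (n + k)`, if `l` is the characteristic of
the residue field of `Q`. -/
lemma exists_finset_incongruent {Q : Ideal R} (hQ : Q.IsPrime) (hQ0 : Q ≠ ⊥) {l : ℕ}
    (hl : l.Prime) (hlQ : (l : R) ∈ Q) (n k : ℕ) :
    ∃ T : Finset R, T.card = l ^ k ∧ (∀ t ∈ T, t ∈ Q ^ n) ∧
      ∀ t ∈ T, ∀ t' ∈ T, t - t' ∈ Q ^ (n + k) → t = t' := by
  classical
  induction k with
  | zero => exact ⟨{0}, by simp, by simp, by simp⟩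
  | succ k ih =>
    obtain ⟨T, hcard, hT, hinj⟩ := ih
    obtain ⟨s, hs, hs'⟩ := Ideal.exists_mem_pow_notMem_pow_succ Q hQ0 hQ.ne_top (n + k)
    have key : ∀ t ∈ T, ∀ t' ∈ T, ∀ a ∈ Finset.range l, ∀ a' ∈ Finset.range l,
        (t + a * s) - (t' + a' * s) ∈ Q ^ (n + (k + 1)) → t = t' ∧ a = a' := by
      intro t ht t' ht' a ha a' ha' H
      have h1 : t = t' := by
        refine hinj t ht t' ht' ?_
        have := sub_mem (Ideal.pow_le_pow_right (show n + k ≤ n + (k + 1) by omega) H)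
          (Ideal.mul_mem_left _ ((a : R) - a') hs)
        convert this using 1
        ring
      refine ⟨h1, ?_⟩
      subst h1
      by_contra hne
      have h2 : ((a : R) - a') * s ∈ Q ^ (n + k + 1) := by
        have h3 : ((a : R) - a') * s = t + a * s - (t + a' * s) := by ring
        rw [h3]
        exact H
      rcases Ideal.IsPrime.mul_mem_pow Q h2 with h3 | h3
      · have hcop : IsCoprime ((a : ℤ) - a') (l : ℤ) := by
          rw [isCoprime_comm, (Nat.prime_iff_prime_int.1 hl).coprime_iff_not_dvd]
          intro hdvd
          have h4 := Int.eq_zero_of_abs_lt_dvd hdvd (by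
            rw [Finset.mem_range] at ha ha'
            rw [abs_lt]
            omega)
          omega
        obtain ⟨c, d, hcd⟩ := hcop
        refine hQ.ne_top ((Ideal.eq_top_iff_one Q).2 ?_)
        have h5 : (1 : R) = c * ((a : R) - a') + d * l := by
          exact_mod_cast (congrArg (Int.cast : ℤ → R) hcd).symm
        rw [h5]
        exact add_mem (Q.mul_mem_left _ h3) (Q.mul_mem_left _ hlQ)
      · exact hs' h3
    refine ⟨(T ×ˢ Finset.range l).image fun z => z.1 + z.2 * s, ?_, ?_, ?_⟩
    · rw [Finset.card_image_of_injOn, Finset.card_product, hcard, Finset.card_range, pow_succ]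
      rintro ⟨t, a⟩ h1 ⟨t', a'⟩ h2 H
      simp only [Finset.coe_product, Set.mem_prod, Finset.mem_coe] at h1 h2
      have := key t h1.1 t' h2.1 a h1.2 a' h2.2 (by
        have H' : t + a * s = t' + a' * s := H
        simp [H'])
      rw [this.1, this.2]
    · intro z hz
      obtain ⟨⟨t, a⟩, h1, rfl⟩ := Finset.mem_image.1 hz
      exact add_mem (hT _ (Finset.mem_product.1 h1).1)
        (Ideal.mul_mem_left _ _ (Ideal.pow_le_pow_right (Nat.le_add_right n k) hs))
    · intro z hz z' hz' H
      obtain ⟨⟨t, a⟩, h1, rfl⟩ := Finset.mem_image.1 hz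
      obtain ⟨⟨t', a'⟩, h2, rfl⟩ := Finset.mem_image.1 hz'
      rw [Finset.mem_product] at h1 h2
      have := key t h1.1 t' h2.1 a h1.2 a' h2.2 H
      simp only [this.1, this.2]

/-- If `l ∈ Q ^ 2`, then the elements `± π ^ k` are not `Q`-adically dense near any `x₀ ∉ Q`.
For large `N`, the group `(1 + Q ^ N) / (1 + Q ^ (N + 6))` has at least `l ^ 6` elements and is
killed by `l ^ 3`, whereas the group generated by `-1` and `π` modulo `Q ^ (N + 6)` has at most
`4 * l ^ 3` elements killed by `2 * l ^ 3`. -/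
theorem not_dense_powers {Q : Ideal R} (hQ : Q.IsPrime) (hQ0 : Q ≠ ⊥) {l : ℕ} (hl : l.Prime)
    (hlQ : (l : R) ∈ Q ^ 2) {π x₀ : R} (hπ : π ∉ Q) (hx₀ : x₀ ∉ Q) (n : ℕ) :
    ¬ ∀ y : R, y - x₀ ∈ Q ^ (n + 1) → ∀ m, ∃ k : ℕ, π ^ k - y ∈ Q ^ m ∨ -π ^ k - y ∈ Q ^ m := by
  classical
  intro H
  have hm := hQ.isMaximal hQ0
  set N := n + 2 with hN
  set f := Ideal.Quotient.mk (Q ^ (N + 6)) with hf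
  have hunit : ∀ a : R, a ∉ Q → IsUnit (f a) := by
    intro a ha
    have h1 : (1 : R) ∈ Ideal.span {a} ⊔ Q ^ (N + 6) :=
      span_sup_pow_eq_top hm ha (N + 6) ▸ Submodule.mem_top
    obtain ⟨s, hs, t, ht, e⟩ := Submodule.mem_sup.1 h1
    obtain ⟨c, rfl⟩ := Ideal.mem_span_singleton'.1 hs
    have : f c * f a = 1 := by
      rw [← map_mul, ← map_one f, ← e, map_add, Ideal.Quotient.eq_zero_iff_mem.2 ht, add_zero]
    exact IsUnit.of_mul_eq_one_right _ this
  obtain ⟨g, hg⟩ := hunit π hπ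
  obtain ⟨X, hX⟩ := hunit x₀ hx₀
  obtain ⟨T, hcard, hT, hinj⟩ := exists_finset_incongruent hQ hQ0 hl
    (Ideal.pow_le_self two_ne_zero hlQ) N 6
  have hone : ∀ t ∈ T, 1 + t ∉ Q := fun t ht h1 => hQ.ne_top ((Ideal.eq_top_iff_one Q).2 (by
    simpa using sub_mem h1 (Ideal.pow_le_self (by omega) (hT t ht))))
  have happrox : ∀ t ∈ Q ^ N, ∃ k : ℕ, (g ^ k : (R ⧸ Q ^ (N + 6))) = X * f (1 + t) ∨
      (-g ^ k : (R ⧸ Q ^ (N + 6))) = X * f (1 + t) := by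
    intro t ht
    obtain ⟨k, hk⟩ := H (x₀ * (1 + t)) (by
      have h1 : x₀ * (1 + t) - x₀ = x₀ * t := by ring
      rw [h1]
      exact Ideal.mul_mem_left _ _ (Ideal.pow_le_pow_right (by omega) ht)) (N + 6)
    refine ⟨k, hk.imp (fun h1 => ?_) (fun h1 => ?_)⟩ <;>
    · rw [← Ideal.Quotient.eq] at h1
      rw [hg, hX]
      simpa [hf] using h1
  obtain ⟨k₀, hk₀⟩ := happrox 0 (zero_mem _)
  obtain ⟨S, hS, hS'⟩ := exists_finset_zpow g (N := 2 * l ^ 3) (by have := hl.pos; positivity)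
  have hmem : ∀ t ∈ T, f (1 + t) ∈ (S ∪ S.image fun c => -c).image
      (fun c : (R ⧸ Q ^ (N + 6))ˣ => (c : R ⧸ Q ^ (N + 6))) := by
    intro t ht
    obtain ⟨c, hc⟩ := hunit _ (hone t ht)
    have hpow : c ^ (l ^ 3) = 1 := by
      apply Units.ext
      have h1 := one_add_pow_prime_pow_sub_one_mem hl hlQ (j := N) (u := 1 + t) (by omega)
        (by simpa using hT t ht) 3
      rw [← Ideal.Quotient.eq] at h1
      simpa [hc, hf] using h1
    have hck : ∃ j : ℤ, c = g ^ j ∨ c = -g ^ j := by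
      obtain ⟨k, hk⟩ := happrox t (hT t ht)
      rw [← hc] at hk
      have hX₀ : X = g ^ k₀ ∨ X = -g ^ k₀ :=
        hk₀.imp (fun h1 => Units.ext (by simpa using h1.symm))
          (fun h1 => Units.ext (by simpa using h1.symm))
      have hXc : X * c = g ^ k ∨ X * c = -g ^ k :=
        hk.imp (fun h1 => Units.ext (by simpa using h1.symm))
          (fun h1 => Units.ext (by simpa using h1.symm))
      refine ⟨(k : ℤ) - k₀, ?_⟩
      rw [zpow_sub, zpow_natCast, zpow_natCast, ← div_eq_mul_inv, ← neg_div, eq_div_iff_mul_eq',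
        eq_div_iff_mul_eq']
      rcases hX₀ with rfl | rfl
      · rwa [mul_comm] at hXc
      · rw [mul_comm, mul_neg, neg_eq_iff_eq_neg, neg_inj] at hXc
        exact hXc.symm
    obtain ⟨j, hj⟩ := hck
    have hgS : g ^ j ∈ S := by
      apply hS'
      have h2 : c ^ 2 = (g ^ j) ^ 2 := by rcases hj with rfl | rfl <;> simp
      rw [pow_mul, ← h2, ← pow_mul, mul_comm, pow_mul, hpow, one_pow]
    rw [Finset.mem_image]
    refine ⟨c, ?_, hc⟩
    rw [Finset.mem_union, Finset.mem_image]
    rcases hj with rfl | rfl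
    · exact Or.inl hgS
    · exact Or.inr ⟨_, hgS, rfl⟩
  have hle : T.card ≤ 4 * l ^ 3 := by
    calc T.card ≤ _ := Finset.card_le_card_of_injOn (fun t => f (1 + t)) hmem (by
          intro t ht t' ht' h1
          refine hinj t ht t' ht' ?_
          have h2 := Ideal.Quotient.eq.1 h1
          simpa using h2)
      _ ≤ _ := Finset.card_image_le
      _ ≤ _ := Finset.card_union_le _ _
      _ ≤ S.card + S.card := Nat.add_le_add_left Finset.card_image_le _
      _ ≤ 4 * l ^ 3 := by omega
  rw [hcard] at hle
  have h2 : 2 ^ 3 ≤ l ^ 3 := Nat.pow_le_pow_left hl.two_le 3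
  nlinarith

end Ramified

/-! ### Rings algebraic over the integers whose only units are `±1` -/

section Algebraic

open NumberField IntermediateField

variable {K : Type*} [Field K] [Algebra ℚ K] {R : Type*} [CommRing R] [IsDedekindDomain R]
  [Algebra R K] [IsFractionRing R K]

lemma isUnit_ringOfIntegers_eq (hu : ∀ u : R, IsUnit u → u = 1 ∨ u = -1)
    (F : IntermediateField ℚ K) (u : (𝓞 F)ˣ) : u = 1 ∨ u = -1 := by
  have hmem : ∀ w : 𝓞 F, ∃ r : R, algebraMap R K r = ((w : F) : K) := fun w => by
    have h1 : IsIntegral ℤ ((w : F) : K) :=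
      (RingOfIntegers.isIntegral_coe w).map (algebraMap F K).toIntAlgHom
    exact IsIntegrallyClosed.algebraMap_eq_of_integral (R := R) h1.tower_top
  obtain ⟨r, hr⟩ := hmem u
  obtain ⟨s, hs⟩ := hmem (u⁻¹ : (𝓞 F)ˣ)
  have hrs : r * s = 1 := by
    apply IsFractionRing.injective R K
    rw [map_mul, hr, hs, map_one]
    simp
  have hK : ((u : 𝓞 F) : F) = 1 ∨ ((u : 𝓞 F) : F) = -1 := by
    rcases hu r (IsUnit.of_mul_eq_one s hrs) with rfl | rfl
    · left; exact Subtype.ext (by simpa using hr.symm)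
    · right; exact Subtype.ext (by simpa using hr.symm)
  refine hK.imp (fun h => ?_) (fun h => ?_)
  · exact Units.ext (RingOfIntegers.ext (by simpa using h))
  · exact Units.ext (RingOfIntegers.ext (by simpa using h))

/-- A number field with finitely many units has degree at most `2`, by Dirichlet's unit theorem. -/
lemma finrank_le_two_of_finite_units (F : Type*) [Field F] [NumberField F] [Finite (𝓞 F)ˣ] :
    Module.finrank ℚ F ≤ 2 := by
  have hrank : NumberField.Units.rank F = 0 := by
    rw [← NumberField.Units.finrank_eq, Module.finrank_eq_zero_iff]
    refine fun u => ⟨Nat.card (𝓞 F)ˣ, by exact_mod_cast Nat.card_pos.ne', ?_⟩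
    rw [natCast_zsmul]
    exact congrArg Additive.ofMul (pow_card_eq_one' (x := u.toMul))
  rw [NumberField.Units.rank] at hrank
  have h1 := InfinitePlace.card_eq_nrRealPlaces_add_nrComplexPlaces F
  have h2 := InfinitePlace.card_add_two_mul_card_eq_rank F
  omega

/-- The units of the ring of integers of `ℚ(β)` are units of the integrally closed ring `R`, so they
are finite in number. -/
lemma finrank_adjoin_le_two [Algebra.IsAlgebraic ℚ K] (hu : ∀ u : R, IsUnit u → u = 1 ∨ u = -1)
    (β : K) : Module.finrank ℚ ℚ⟮β⟯ ≤ 2 := by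
  have hβ : IsIntegral ℚ β := (Algebra.IsAlgebraic.isAlgebraic β).isIntegral
  have hfin : FiniteDimensional ℚ ℚ⟮β⟯ := adjoin.finiteDimensional hβ
  have : CharZero K := algebraRat.charZero K
  -- The two `ℚ`-module structures on `ℚ(β)`, one inherited from `K` and one coming from
  -- characteristic zero, agree only propositionally.
  have : NumberField ℚ⟮β⟯ :=
    { to_finiteDimensional := by convert hfin using 1; exact Subsingleton.elim _ _ }
  have : Finite (𝓞 ℚ⟮β⟯)ˣ := Set.finite_univ_iff.1
    ((Set.toFinite {1, -1}).subset fun u _ => isUnit_ringOfIntegers_eq hu _ u)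
  convert finrank_le_two_of_finite_units ℚ⟮β⟯ using 3
  exact Subsingleton.elim _ _

/-- An element of degree two yields the square root of a squarefree integer. -/
lemma exists_sq_eq_squarefree {K : Type*} [Field K] [Algebra ℚ K] {β : K} (hβ : IsIntegral ℚ β)
    (h2 : (minpoly ℚ β).natDegree = 2) :
    ∃ (δ : K) (D : ℤ), δ ^ 2 = D ∧ Squarefree D ∧ D ≠ 1 := by
  have : CharZero K := algebraRat.charZero K
  have hβQ : ∀ r : ℚ, algebraMap ℚ K r ≠ β := by
    intro r hr
    have := minpoly.natDegree_eq_one_iff.2 ⟨r, hr⟩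
    omega
  obtain ⟨b, c, hbc⟩ : ∃ b c : ℚ, β ^ 2 + b * β + c = 0 := by
    refine ⟨(minpoly ℚ β).coeff 1, (minpoly ℚ β).coeff 0, ?_⟩
    have h3 := minpoly.aeval ℚ β
    have hlead : (minpoly ℚ β).coeff 2 = 1 := h2 ▸ (minpoly.monic hβ).coeff_natDegree
    rw [Polynomial.aeval_eq_sum_range, h2, Finset.sum_range_succ, Finset.sum_range_succ,
      Finset.sum_range_one, hlead] at h3
    simp only [Algebra.smul_def, eq_ratCast, pow_zero, pow_one, mul_one, Rat.cast_one, one_mul] at h3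
    linear_combination h3
  -- complete the square and clear denominators
  set r : ℚ := b ^ 2 - 4 * c with hr
  have hδ₀ : (2 * β + b) ^ 2 = ((r : ℚ) : K) := by
    rw [hr]; push_cast; linear_combination 4 * hbc
  have hδQ : ∀ t : ℚ, (t : K) ≠ 2 * β + b := by
    intro t ht
    apply hβQ ((t - b) / 2)
    rw [eq_ratCast]
    push_cast
    rw [ht]
    field_simp
    ring
  have hr0 : r ≠ 0 := by
    intro h0
    rw [h0, Rat.cast_zero, sq_eq_zero_iff] at hδ₀
    exact hδQ 0 (by rw [hδ₀, Rat.cast_zero])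
  obtain ⟨d, s, hsd, hd⟩ := Nat.sq_mul_squarefree (r.num * r.den).natAbs
  have hn0 : r.num * r.den ≠ 0 := mul_ne_zero (Rat.num_ne_zero.2 hr0) (by exact_mod_cast r.den_nz)
  have hs0 : s ≠ 0 := by
    rintro rfl
    rw [zero_pow two_ne_zero, zero_mul] at hsd
    exact hn0 (Int.natAbs_eq_zero.1 hsd.symm)
  obtain ⟨D, hD, hDsq⟩ : ∃ D : ℤ, (s : ℤ) ^ 2 * D = r.num * r.den ∧ Squarefree D := by
    rcases Int.natAbs_eq (r.num * r.den) with h | h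
    · exact ⟨d, by rw [h, ← hsd]; push_cast; ring, Int.squarefree_natCast.2 hd⟩
    · exact ⟨-d, by rw [h, ← hsd]; push_cast; ring, by
        rwa [← Int.squarefree_natAbs, Int.natAbs_neg, Int.natAbs_natCast]⟩
  have hsK : (s : K) ≠ 0 := by exact_mod_cast hs0
  have hdenK : ((r.den : ℕ) : K) ≠ 0 := by exact_mod_cast r.den_nz
  have hDK : (s : K) ^ 2 * D = r.num * r.den := by exact_mod_cast congrArg (Int.cast : ℤ → K) hD
  have hsq : ((r.den : K) * (2 * β + b) / s) ^ 2 = D := by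
    rw [div_pow, mul_pow, hδ₀, div_eq_iff (pow_ne_zero 2 hsK), mul_comm (D : K), hDK]
    rw [Rat.cast_def]
    field_simp
  refine ⟨_, D, hsq, hDsq, ?_⟩
  rintro rfl
  rw [Int.cast_one, _root_.sq_eq_one_iff] at hsq
  rcases hsq with hsq | hsq
  · apply hδQ (s / r.den)
    push_cast
    rw [div_eq_iff hdenK]
    linear_combination -(div_eq_iff hsK).1 hsq
  · apply hδQ (-s / r.den)
    push_cast
    rw [div_eq_iff hdenK]
    linear_combination -(div_eq_iff hsK).1 hsq

/-- If `δ ^ 2 = D` with `D` squarefree, then a prime `l` dividing `D` ramifies. -/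
lemma natCast_mem_sq {R : Type*} [CommRing R] [IsDedekindDomain R] {δ : R} {D : ℤ}
    (hδ : δ ^ 2 = D) (hD : Squarefree D) {l : ℕ} (hl : l.Prime) (hlD : (l : ℤ) ∣ D) {Q : Ideal R}
    (hQ : Q.IsPrime) (hlQ : (l : R) ∈ Q) : (l : R) ∈ Q ^ 2 := by
  obtain ⟨m, rfl⟩ := hlD
  have hlp := Nat.prime_iff_prime_int.1 hl
  have hcop : IsCoprime (l : ℤ) m := by
    rw [hlp.coprime_iff_not_dvd]
    rintro ⟨c, rfl⟩
    exact hlp.not_isUnit (hD l ⟨c, by ring⟩)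
  obtain ⟨c, d, hcd⟩ := hcop
  have hcdR : (c : R) * l + d * m = 1 := by exact_mod_cast congrArg (Int.cast : ℤ → R) hcd
  push_cast at hδ
  have hδQ : δ ∈ Q := hQ.mem_of_pow_mem 2 (hδ ▸ Q.mul_mem_right _ hlQ)
  have h1 : (l : R) * m ∈ Q ^ 2 := hδ ▸ Ideal.pow_mem_pow hδQ 2
  have e : (l : R) = l ^ 2 * c + l * m * d := by linear_combination -(l : R) * hcdR
  rw [e]
  exact add_mem (Ideal.mul_mem_right _ _ (Ideal.pow_mem_pow hlQ 2)) (Ideal.mul_mem_right _ _ h1)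

/-- If a Dedekind domain algebraic over `ℤ` has only the units `±1`, then it is `ℤ` or it has a
ramified prime. -/
theorem bijective_or_exists_ramified [Algebra.IsAlgebraic ℚ K]
    (hu : ∀ u : R, IsUnit u → u = 1 ∨ u = -1) [CharZero R] :
    Function.Bijective (Int.castRingHom R) ∨
      ∃ (l : ℕ) (Q : Ideal R), l.Prime ∧ Q.IsPrime ∧ Q ≠ ⊥ ∧ (l : R) ∈ Q ^ 2 := by
  have : CharZero K := algebraRat.charZero K
  have hint : ∀ β : K, IsIntegral ℚ β := fun β => (Algebra.IsAlgebraic.isAlgebraic β).isIntegral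
  by_cases hdeg : ∃ β : K, (minpoly ℚ β).natDegree = 2
  · right
    obtain ⟨β, hβ⟩ := hdeg
    obtain ⟨δ, D, hδ, hD, hD1⟩ := exists_sq_eq_squarefree (hint β) hβ
    obtain ⟨δ, rfl⟩ : ∃ x : R, algebraMap R K x = δ :=
      IsIntegrallyClosed.algebraMap_eq_of_integral (IsIntegral.of_pow two_pos (by
        rw [hδ, ← map_intCast (algebraMap R K)]; exact isIntegral_algebraMap))
    have hδR : δ ^ 2 = D := IsFractionRing.injective R K (by simpa using hδ)
    have hDu : ¬ IsUnit D := by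
      intro H
      rcases Int.isUnit_iff.1 H with rfl | rfl
      · exact hD1 rfl
      · -- `δ` would be a unit of order four
        have hδu : IsUnit δ := IsUnit.of_mul_eq_one (-δ) (by
          push_cast at hδR; linear_combination -hδR)
        have : ((1 : ℤ) : R) = ((-1 : ℤ) : R) := by
          rw [← hδR]
          rcases hu δ hδu with rfl | rfl <;> simp
        exact absurd (Int.cast_injective this) (by norm_num)
    obtain ⟨l, hl, hlD⟩ := Int.exists_prime_and_dvd (fun H => hDu (Int.isUnit_iff_natAbs_eq.2 H))
    obtain ⟨p, hp, hlp⟩ : ∃ p : ℕ, p.Prime ∧ (p : ℤ) ∣ D :=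
      ⟨l.natAbs, Int.prime_iff_natAbs_prime.1 hl, Int.natAbs_dvd.2 hlD⟩
    have hpu : ¬ IsUnit (p : R) := by
      intro H
      rcases hu _ H with h1 | h1
      · exact hp.one_lt.ne' (by exact_mod_cast h1)
      · have h2 : ((p : ℤ) : R) = ((-1 : ℤ) : R) := by simpa using h1
        have := Int.cast_injective h2
        omega
    obtain ⟨Q, hQ, hpQ⟩ := exists_max_ideal_of_mem_nonunits hpu
    exact ⟨p, Q, hp, hQ.isPrime, fun h0 => hp.ne_zero (by simpa [h0] using hpQ),
      natCast_mem_sq hδR hD hp hlp hQ.isPrime hpQ⟩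
  · left
    refine ⟨Int.cast_injective, fun x => ?_⟩
    have hdeg1 : (minpoly ℚ (algebraMap R K x)).natDegree = 1 := by
      have h1 := finrank_adjoin_le_two hu (algebraMap R K x)
      rw [adjoin.finrank (hint _)] at h1
      have h2 := minpoly.natDegree_pos (hint (algebraMap R K x))
      have h3 : (minpoly ℚ (algebraMap R K x)).natDegree ≠ 2 := fun h => hdeg ⟨_, h⟩
      omega
    obtain ⟨r, hr⟩ := minpoly.natDegree_eq_one_iff.1 hdeg1
    have hx : (r.den : R) * x = r.num := by
      apply IsFractionRing.injective R K
      rw [map_mul, map_natCast, map_intCast, ← hr, eq_ratCast]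
      exact_mod_cast Rat.den_mul_eq_num r
    obtain ⟨c, d, hcd⟩ := Rat.isCoprime_num_den r
    have hcdR : (c : R) * r.num + d * r.den = 1 := by
      exact_mod_cast congrArg (Int.cast : ℤ → R) hcd
    rcases hu (r.den : R) (IsUnit.of_mul_eq_one (b := c * x + d)
      (by linear_combination hcdR + c * hx)) with h1 | h1
    · exact ⟨r.num, by rw [h1, one_mul] at hx; exact hx.symm⟩
    · exact ⟨-r.num, by rw [h1, neg_one_mul] at hx; simp [← hx]⟩

end Algebraic

/-! ### The Golomb space of the integers -/

section Main

open GolombSpace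

theorem mainTheorem2 {K : Type*} [Field K] [Algebra ℚ K] [Algebra.IsAlgebraic ℚ K]
    {R : Type*} [CommRing R] [IsDedekindDomain R] [Algebra R K] [IsFractionRing R K]
    (h : Nonempty (GolombSpace R ≃ₜ GolombSpace ℤ)) :
    Function.Bijective (Int.castRingHom R) := by
  obtain ⟨h⟩ := h
  have : CharZero K := algebraRat.charZero K
  have : CharZero R := ⟨fun m n hmn => by
    have := congrArg (algebraMap R K) hmn
    simpa using this⟩
  have hR : (2 : R) ≠ 0 := two_ne_zero
  have hZ : (2 : ℤ) ≠ 0 := two_ne_zero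
  -- `R` has exactly two units, since they correspond to those of `ℤ`.
  have hu : ∀ u : R, IsUnit u → u = 1 ∨ u = -1 := by
    intro u hu
    by_contra! hne
    have hval : ∀ x : GolombSpace R, IsUnit x.1 → (h x).1 = 1 ∨ (h x).1 = -1 := fun x hx =>
      Int.isUnit_iff.1 ((isUnit_map_iff hR hZ h x).2 hx)
    have hinj : ∀ x y : GolombSpace R, (h x).1 = (h y).1 → x.1 = y.1 := fun x y hxy =>
      congrArg Subtype.val (h.injective (Subtype.ext hxy))
    obtain ⟨U, rfl⟩ : ∃ U : GolombSpace R, U.1 = u := ⟨⟨u, hu.ne_zero⟩, rfl⟩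
    obtain ⟨V, hV⟩ : ∃ V : GolombSpace R, V.1 = 1 := ⟨⟨1, one_ne_zero⟩, rfl⟩
    obtain ⟨W, hW⟩ : ∃ W : GolombSpace R, W.1 = -1 := ⟨⟨-1, neg_ne_zero.2 one_ne_zero⟩, rfl⟩
    have h1 : (1 : R) ≠ -1 := fun H => hR (by linear_combination H)
    have n1 : (h U).1 ≠ (h V).1 := fun H => hne.1 (hV ▸ hinj U V H)
    have n2 : (h U).1 ≠ (h W).1 := fun H => hne.2 (hW ▸ hinj U W H)
    have n3 : (h V).1 ≠ (h W).1 := fun H => h1 (hV.symm.trans ((hinj V W H).trans hW))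
    have := hval U hu
    have := hval V (hV ▸ isUnit_one)
    have := hval W (hW ▸ isUnit_one.neg)
    omega
  refine (bijective_or_exists_ramified (K := K) hu).resolve_right ?_
  rintro ⟨l, Q, hl, hQ, hQ0, hlQ⟩
  obtain ⟨b, hb, hbQ⟩ := exists_mem_map_prime hR hZ h hQ hQ0
  have hmemQ := mem_iff_map_prime_dvd hR hZ h hb hQ hbQ
  -- Let `q` be the prime number matched with `Q`, and let `P` be matched with another one, `p`.
  obtain ⟨q, hq, hqb⟩ : ∃ q : ℕ, q.Prime ∧ ∀ x : GolombSpace R, x.1 ∈ Q ↔ (q : ℤ) ∣ (h x).1 :=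
    ⟨(h b).1.natAbs, Int.prime_iff_natAbs_prime.1 hb, fun x => by rw [hmemQ, Int.natAbs_dvd]⟩
  obtain ⟨p, hqp, hp⟩ := Nat.exists_infinite_primes (q + 1)
  have hpq : p ≠ q := by omega
  have hp' : Prime (p : ℤ) := Nat.prime_iff_prime_int.1 hp
  have hq' : Prime (q : ℤ) := Nat.prime_iff_prime_int.1 hq
  obtain ⟨a, ha⟩ : ∃ a : GolombSpace R, (h a).1 = p :=
    ⟨h.symm ⟨p, hp'.ne_zero⟩, congrArg Subtype.val (h.apply_symm_apply _)⟩
  have hpa : Prime (h a).1 := ha ▸ hp'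
  obtain ⟨P, hP, haP⟩ : ∃ P : Ideal R, P.IsPrime ∧ a.1 ∈ P := by
    have hau : ¬ IsUnit a.1 := fun H => hpa.not_isUnit ((isUnit_map_iff hR hZ h a).2 H)
    obtain ⟨P, hP, haP⟩ := exists_max_ideal_of_mem_nonunits hau
    exact ⟨P, hP.isPrime, haP⟩
  have hP0 : P ≠ ⊥ := fun H => a.2 (by simpa [H] using haP)
  have hPQ : Q ≠ P := by
    rintro rfl
    have h1 := (hqb a).1 haP
    rw [ha] at h1
    exact hpq ((Nat.prime_dvd_prime_iff_eq hq hp).1 (by exact_mod_cast h1)).symm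
  obtain ⟨π, hπ, hgen⟩ := exists_generator_of_pow hu hP hP0
  -- The points of `R` matched with powers of `p` generate powers of `P`.
  have hpow : ∀ (z : GolombSpace R) (k : ℕ), (h z).1 = (p : ℤ) ^ k →
      ∃ k : ℕ, z.1 = π ^ k ∨ z.1 = -π ^ k := by
    intro z k hz
    obtain ⟨m, hm⟩ := span_eq_pow_of_forall_prime hP hP0 z.2 fun Q' hQ' hzQ' => by
      have hQ'0 : Q' ≠ ⊥ := fun H => z.2 (by simpa [H] using hzQ')
      obtain ⟨c, hc, hcQ'⟩ := exists_mem_map_prime hR hZ h hQ' hQ'0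
      have h1 := (mem_iff_map_prime_dvd hR hZ h hc hQ' hcQ' z).1 hzQ'
      rw [hz] at h1
      have h2 : Associated (h c).1 (p : ℤ) :=
        (hc.dvd_prime_iff_associated hp').1 (hc.dvd_of_dvd_pow h1)
      have haQ' : a.1 ∈ Q' := by
        rw [mem_iff_map_prime_dvd hR hZ h hc hQ' hcQ', ha]
        exact h2.dvd
      exact eq_of_map_prime hR hZ h hpa hQ' hP haQ' haP
    exact hgen _ m hm
  obtain ⟨n, hn⟩ := exists_prime_pow_sub_dvd hp hq hpq
  have hqI : (Ideal.span {(q : ℤ)}).IsPrime := (Ideal.span_singleton_prime hq'.ne_zero).2 hq'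
  obtain ⟨one, hone⟩ : ∃ w : GolombSpace ℤ, w.1 = 1 := ⟨⟨1, one_ne_zero⟩, rfl⟩
  obtain ⟨x₀, k₀, hx₀, H⟩ := exists_dense_of_dense h hQ hQ0 hqI
    (by simpa using hq'.ne_zero) (fun x => by rw [Ideal.mem_span_singleton, hqb])
    {z | ∃ k : ℕ, z.1 = (p : ℤ) ^ k} (w := one) (n := n)
    (by rw [hone, Ideal.mem_span_singleton]; exact hq'.not_dvd_one) (by
      intro y hy m
      have hy' : y.1 - one.1 ∈ Ideal.span {(q : ℤ)} ^ (n + 1) := hy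
      rw [hone, Ideal.span_singleton_pow, Ideal.mem_span_singleton] at hy'
      obtain ⟨k, hk⟩ := hn y.1 hy' m
      refine ⟨⟨(p : ℤ) ^ k, pow_ne_zero k hp'.ne_zero⟩, ⟨k, rfl⟩, ?_⟩
      change (p : ℤ) ^ k - y.1 ∈ Ideal.span {(q : ℤ)} ^ m
      rw [Ideal.span_singleton_pow, Ideal.mem_span_singleton]
      exact (dvd_sub_comm).1 hk)
  refine not_dense_powers hQ hQ0 hl hlQ (hπ Q hQ hPQ) hx₀ k₀ fun y hy m => ?_
  have hy0 : y ≠ 0 := by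
    rintro rfl
    exact hx₀ (by simpa using Ideal.pow_le_self (by omega) hy)
  obtain ⟨z, ⟨k, hk⟩, hz⟩ := H ⟨y, hy0⟩ hy m
  obtain ⟨k, hk⟩ := hpow z k hk
  exact ⟨k, hk.imp (fun e => by rwa [← e]) (fun e => by rwa [← e])⟩

end Main
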